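/- For a finite graph $G$, the simplex graph $\kappa(G)$ has one vertex for each clique of $G$ (the empty set, single vertices and edges count as cliques), two vertices being adjacent when the cliques differ by exactly one vertex; a simplex graph is a graph isomorphic to some $\kappa(G)$. Let $Q_d$ be the $d$-cube on the binary strings of length $d$, and for $d\ge 1$ let the Fibonacci cube $\Gamma_d$ be the subgraph of $Q_d$ induced by the strings without two consecutive ones. An isometric embedding is a map between vertex sets that preserves shortest-path distances. Let $\mathrm{idim}(H)$ be the smallest $k$ such that $H$ has an isometric embedding into $Q_k$, and $\mathrm{fdim}(H)$ the smallest $f\ge 1$ such that $H$ has an isometric embedding into $\Gamma_f$. **Theorem.** Let $\varepsilon\in(0,1)$ be a constant. Given a simplex graph $H$ with $n$ vertices and an isometric embedding $H\to Q_k$, where $k=\mathrm{idim}(H)$, one can compute in $O(n^{2+1/\varepsilon})$ time (on a word RAM with words of $O(\log n)$ bits, the implied constants depending only on $\varepsilon$) an isometric embedding of $H$ into $\Gamma_{f'}$ for some $f'\le(1+\varepsilon)\,\mathrm{fdim}(H)$. -/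

import Mathlib

namespace FibDim

/-! ## Graphs and dimensions -/

/-- A map between the vertex sets of two graphs that preserves all shortest-path distances
(`⊤` for pairs in different components). Such a map is automatically injective. -/
def IsIsometricEmbedding {V W : Type*} (G : SimpleGraph V) (H : SimpleGraph W) (φ : V → W) :
    Prop :=
  ∀ u v, H.edist (φ u) (φ v) = G.edist u v

/-- The `d`-cube `Q_d`: binary strings of length `d`, adjacent when they differ in exactly one
position. -/
def cube (d : ℕ) : SimpleGraph (Fin d → Bool) where
  Adj u v := hammingDist u v = 1
  symm := ⟨fun u v h => by rw [hammingDist_comm]; exact h⟩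
  loopless := ⟨fun u h => by simp at h⟩

/-- A Fibonacci string: a binary string without two consecutive ones. -/
def IsFibString {d : ℕ} (u : Fin d → Bool) : Prop :=
  ∀ i j : Fin d, (j : ℕ) = i + 1 → ¬ (u i = true ∧ u j = true)

/-- The Fibonacci cube `Γ_d`: the subgraph of `Q_d` induced by the Fibonacci strings. -/
def fibonacciCube (d : ℕ) : SimpleGraph {u : Fin d → Bool // IsFibString u} :=
  (cube d).induce {u | IsFibString u}

/-- The isometric dimension (`⊤` if there is no isometric embedding into a cube). -/
noncomputable def idim {V : Type*} (G : SimpleGraph V) : ℕ∞ :=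
  ⨅ (k : ℕ) (_ : ∃ φ, IsIsometricEmbedding G (cube k) φ), (k : ℕ∞)

/-- The Fibonacci dimension (`⊤` if there is no isometric embedding into a Fibonacci cube
`Γ_f`, `f ≥ 1`). -/
noncomputable def fdim {V : Type*} (G : SimpleGraph V) : ℕ∞ :=
  ⨅ (f : ℕ) (_ : 1 ≤ f ∧ ∃ φ, IsIsometricEmbedding G (fibonacciCube f) φ), (f : ℕ∞)

/-- The simplex graph `κ(G)`: its vertices are the cliques of `G` (including `∅`), two of them
being adjacent when they differ by exactly one vertex. -/
def simplexGraph {V : Type*} [DecidableEq V] (G : SimpleGraph V) :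
    SimpleGraph {K : Finset V // G.IsClique (K : Set V)} where
  Adj K L := (symmDiff K.1 L.1).card = 1
  symm := ⟨fun K L h => by rw [symmDiff_comm]; exact h⟩
  loopless := ⟨fun K h => by simp at h⟩

/-- `H` is (isomorphic to) the simplex graph of some finite graph. -/
def IsSimplexGraph {V : Type*} (H : SimpleGraph V) : Prop :=
  ∃ (m : ℕ) (G : SimpleGraph (Fin m)), Nonempty (H ≃g simplexGraph G)

/-! ## A word RAM

Programs are structured (`seq`, `cond`, `loop`). A state has registers and a number of memory
banks; a program names finitely many of each, and every bank is addressed indirectly. All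
quantities occurring in a run have to be words, that is, natural numbers below a bound `B`
(`B = 2 ^ w` for words of `w` bits): a run in which a larger number would occur gets stuck. -/

/-- The arithmetic operations of the machine. Subtraction is truncated, a quotient by zero is
zero, and comparisons give `0` or `1`. -/
inductive Op
  | add | sub | mul | div | mod | lt | eq

def Op.apply : Op → ℕ → ℕ → ℕ
  | .add, x, y => x + y
  | .sub, x, y => x - y
  | .mul, x, y => x * y
  | .div, x, y => x / y
  | .mod, x, y => x % y
  | .lt, x, y => if x < y then 1 else 0
  | .eq, x, y => if x = y then 1 else 0

structure State where
  /-- contents of the registers -/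
  reg : ℕ → ℕ
  /-- `mem b a` is the content of the cell with address `a` in bank `b` -/
  mem : ℕ → ℕ → ℕ

inductive Expr
  | lit (c : ℕ)
  | reg (x : ℕ)
  | load (b : ℕ) (addr : Expr)
  | bin (o : Op) (e₁ e₂ : Expr)

namespace Expr

def eval (s : State) : Expr → ℕ
  | lit c => c
  | reg x => s.reg x
  | load b e => s.mem b (e.eval s)
  | bin o e₁ e₂ => o.apply (e₁.eval s) (e₂.eval s)

/-- All values that occur in the evaluation of the expression are below `B`. -/
def Fits (B : ℕ) (s : State) : Expr → Prop
  | lit c => c < B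
  | reg x => s.reg x < B
  | load b e => e.Fits B s ∧ s.mem b (e.eval s) < B
  | bin o e₁ e₂ => e₁.Fits B s ∧ e₂.Fits B s ∧ o.apply (e₁.eval s) (e₂.eval s) < B

/-- The number of elementary steps needed to evaluate the expression: one for each constant,
register access, memory access and arithmetic operation. -/
def cost : Expr → ℕ
  | lit _ => 1
  | reg _ => 1
  | load _ e => e.cost + 1
  | bin _ e₁ e₂ => e₁.cost + e₂.cost + 1

end Expr

inductive Cmd
  | nop
  /-- write the value of `e` to register `x` -/
  | assign (x : ℕ) (e : Expr)
  /-- write the value of `e` to the cell with address `addr` in bank `b` -/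
  | store (b : ℕ) (addr e : Expr)
  | seq (p q : Cmd)
  /-- continue with `p` if the value of `e` is nonzero, and with `q` otherwise -/
  | cond (e : Expr) (p q : Cmd)
  /-- repeat `p` as long as the value of `e` is nonzero -/
  | loop (e : Expr) (p : Cmd)

/-- `Exec B p s t s'`: on words below `B`, the program `p` started in state `s` halts after
exactly `t` elementary steps, in state `s'`. -/
inductive Exec (B : ℕ) : Cmd → State → ℕ → State → Prop
  | nop (s : State) : Exec B .nop s 1 s
  | assign {s : State} {x : ℕ} {e : Expr} (he : e.Fits B s) :
      Exec B (.assign x e) s (e.cost + 1)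
        { s with reg := Function.update s.reg x (e.eval s) }
  | store {s : State} {b : ℕ} {a e : Expr} (ha : a.Fits B s) (he : e.Fits B s) :
      Exec B (.store b a e) s (a.cost + e.cost + 1)
        { s with mem :=
            Function.update s.mem b (Function.update (s.mem b) (a.eval s) (e.eval s)) }
  | seq {p q : Cmd} {s s₁ s₂ : State} {t₁ t₂ : ℕ} (h₁ : Exec B p s t₁ s₁)
      (h₂ : Exec B q s₁ t₂ s₂) : Exec B (.seq p q) s (t₁ + t₂) s₂
  | cond_true {e : Expr} {p q : Cmd} {s s₁ : State} {t : ℕ} (he : e.Fits B s)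
      (hv : e.eval s ≠ 0) (h : Exec B p s t s₁) : Exec B (.cond e p q) s (e.cost + 1 + t) s₁
  | cond_false {e : Expr} {p q : Cmd} {s s₁ : State} {t : ℕ} (he : e.Fits B s)
      (hv : e.eval s = 0) (h : Exec B q s t s₁) : Exec B (.cond e p q) s (e.cost + 1 + t) s₁
  | loop_done {e : Expr} {p : Cmd} {s : State} (he : e.Fits B s) (hv : e.eval s = 0) :
      Exec B (.loop e p) s (e.cost + 1) s
  | loop_step {e : Expr} {p : Cmd} {s s₁ s₂ : State} {t₁ t₂ : ℕ} (he : e.Fits B s)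
      (hv : e.eval s ≠ 0) (h₁ : Exec B p s t₁ s₁) (h₂ : Exec B (.loop e p) s₁ t₂ s₂) :
      Exec B (.loop e p) s (e.cost + 1 + t₁ + t₂) s₂

/-- The machine is deterministic: running time and final state are determined by the program
and the initial state. -/
theorem Exec.unique {B : ℕ} {p : Cmd} {s s₁ s₂ : State} {t₁ t₂ : ℕ}
    (h₁ : Exec B p s t₁ s₁) (h₂ : Exec B p s t₂ s₂) : t₁ = t₂ ∧ s₁ = s₂ := by
  induction h₁ generalizing t₂ s₂ with
  | nop s => cases h₂; exact ⟨rfl, rfl⟩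
  | assign he => cases h₂; exact ⟨rfl, rfl⟩
  | store ha he => cases h₂; exact ⟨rfl, rfl⟩
  | seq _ _ ih₁ ih₂ =>
    cases h₂ with
    | seq k₁ k₂ =>
      obtain ⟨rfl, rfl⟩ := ih₁ k₁
      obtain ⟨rfl, rfl⟩ := ih₂ k₂
      exact ⟨rfl, rfl⟩
  | cond_true _ hv _ ih =>
    cases h₂ with
    | cond_true _ _ k => obtain ⟨rfl, rfl⟩ := ih k; exact ⟨rfl, rfl⟩
    | cond_false _ hw _ => exact absurd hw hv
  | cond_false _ hv _ ih =>
    cases h₂ with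
    | cond_true _ hw _ => exact absurd hv hw
    | cond_false _ _ k => obtain ⟨rfl, rfl⟩ := ih k; exact ⟨rfl, rfl⟩
  | loop_done _ hv =>
    cases h₂ with
    | loop_done => exact ⟨rfl, rfl⟩
    | loop_step _ hw _ _ => exact absurd hv hw
  | loop_step _ hv _ _ ih₁ ih₂ =>
    cases h₂ with
    | loop_done _ hw => exact absurd hw hv
    | loop_step _ _ k₁ k₂ =>
      obtain ⟨rfl, rfl⟩ := ih₁ k₁
      obtain ⟨rfl, rfl⟩ := ih₂ k₂
      exact ⟨rfl, rfl⟩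

/-! ## Input and output -/

/-- A binary table with `r` rows and `c` columns, stored row by row from address `0` on (the
entry in row `i` and column `j` at address `i * c + j`), followed by zeros. -/
def tableCells {r c : ℕ} (T : Fin r → Fin c → Bool) (a : ℕ) : ℕ :=
  if h : a < r * c then (T (Fin.divNat ⟨a, h⟩) (Fin.modNat ⟨a, h⟩)).toNat else 0

open Classical in
/-- The initial state for a graph `H` on the vertices `0, …, n - 1` with a labelling `β` of its
vertices by binary strings of length `k`: register `0` holds `n`, register `1` holds `k`,
bank `0` holds the table of `β`, bank `1` the adjacency matrix of `H`; everything else is zero. -/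
noncomputable def inputState {n k : ℕ} (H : SimpleGraph (Fin n)) (β : Fin n → Fin k → Bool) :
    State where
  reg
    | 0 => n
    | 1 => k
    | _ => 0
  mem
    | 0 => tableCells β
    | 1 => tableCells fun u v => decide (H.Adj u v)
    | _ => fun _ => 0

/-- The state `s` holds as output the labelling `γ` by binary strings of length `f`: register `0`
holds `f`, and bank `2` holds the table of `γ`, row by row from address `0` on. -/
def IsOutput {n : ℕ} (s : State) (f : ℕ) (γ : Fin n → Fin f → Bool) : Prop :=
  s.reg 0 = f ∧ ∀ (v : Fin n) (i : Fin f), s.mem 2 (v * f + i) = (γ v i).toNat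

end FibDim

namespace FibDim

/-! ## Distances in cubes and simplex graphs -/

/-! An isometric embedding of `H` into a Fibonacci cube keeps the `k` coordinates of the given
embedding, up to complements, and only chooses positions for them. Fix a vertex `r` of degree `k`;
the empty clique is one. Call two coordinates in conflict when some vertex differs from `r` in both.
Such a vertex, `r` and two neighbours of `r` realise all four bit pairs, so conflicting coordinates
never get consecutive positions (`exists_positions`). Conversely, a placement that respects this,
complemented so that `r` becomes the zero string, is an isometric embedding (`exists_embedding`). So
one looks for an ordering of the coordinates with few breaks, a break being a position left empty
between two conflicting successors. The least number of breaks added to `k` is a lower bound for the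
Fibonacci dimension (`card_add_minBreaks_le_of_embedding`).

The greedy ordering moves on without a break whenever it can. A break after `c` means that `c`
conflicts with everything left, so the sources of breaks are pairwise in conflict (`IsGreedy.step`).
They correspond to a clique of the underlying graph, all of whose subsets are vertices of `H`; hence
`b` breaks force `2 ^ b ≤ n` (`two_pow_card_le`).

Let `m = ⌈1/ε⌉`. If the greedy length `k + b` is at most `(1 + 1/m) k`, it is good enough, as the
dimension is at least `k`. Otherwise `k < m b`, so `2 ^ k ≤ n ^ m`, and an exact Held–Karp dynamic
program over all sets of coordinates takes `O(n ^ (m + 1))` steps (`two_pow_mul_le`), within the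
allowed `n ^ (2 + 1/ε)`. The remainder realises this on the word RAM, with time and overflow bounds,
and is assembled in `runs_mainCmd`. -/

/-- Descent along `δ` builds a walk of length `δ u v`; the Lipschitz condition forbids a shorter
one. -/
theorem edist_eq_of_descent {V : Type*} {G : SimpleGraph V} {δ : V → V → ℕ}
    (h0 : ∀ u v, δ u v = 0 ↔ u = v) (hlip : ∀ u w v, G.Adj u w → δ u v ≤ δ w v + 1)
    (hdesc : ∀ u v, δ u v ≠ 0 → ∃ w, G.Adj u w ∧ δ w v + 1 = δ u v) (u v : V) :
    G.edist u v = δ u v := by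
  apply le_antisymm
  · generalize hs : δ u v = s
    induction s generalizing u with
    | zero => rw [(h0 u v).1 hs]; simp
    | succ s ih =>
      obtain ⟨w, hw, hd⟩ := hdesc u v (by omega)
      calc G.edist u v ≤ G.edist u w + G.edist w v := G.edist_triangle
        _ ≤ 1 + (s : ℕ∞) := add_le_add (SimpleGraph.edist_le_one_iff_adj_or_eq.2 (Or.inl hw))
            (ih w (by omega))
        _ = ((s + 1 : ℕ) : ℕ∞) := by push_cast; exact add_comm _ _
  · have key : ∀ {u v : V} (p : G.Walk u v), δ u v ≤ p.length := by
      intro u v p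
      induction p with
      | nil => simp [(h0 _ _).2 rfl]
      | cons h p ih =>
        have := hlip _ _ _ h |>.trans (Nat.add_le_add_right ih 1)
        simpa using this
    by_cases h : G.edist u v = ⊤
    · rw [h]; exact le_top
    · obtain ⟨p, hp⟩ := G.exists_walk_of_edist_ne_top h
      rw [← hp]
      exact_mod_cast key p

theorem hammingDist_update {d : ℕ} (u v : Fin d → Bool) (i : Fin d) (h : u i ≠ v i) :
    hammingDist (Function.update u i (v i)) v + 1 = hammingDist u v := by
  unfold hammingDist
  have : Finset.univ.filter (fun j => Function.update u i (v i) j ≠ v j)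
      = (Finset.univ.filter (fun j => u j ≠ v j)).erase i := by
    ext j
    by_cases hj : j = i
    · subst hj; simp
    · simp [hj]
  rw [this]
  exact Finset.card_erase_add_one (by simp [h])

theorem hammingDist_update_self {d : ℕ} (u v : Fin d → Bool) (i : Fin d) (h : u i ≠ v i) :
    hammingDist u (Function.update u i (v i)) = 1 := by
  rw [hammingDist, Finset.card_eq_one]
  refine ⟨i, ?_⟩
  ext j
  by_cases hj : j = i
  · subst hj; simp [h]
  · simp [hj]

theorem edist_cube {d : ℕ} (u v : Fin d → Bool) :
    (cube d).edist u v = (hammingDist u v : ℕ) := by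
  apply edist_eq_of_descent (δ := fun u v => hammingDist u v)
  · intro u v; exact hammingDist_eq_zero
  · intro u w v h
    have h : hammingDist u w = 1 := h
    have := hammingDist_triangle u w v
    omega
  · intro u v h
    obtain ⟨i, hi⟩ := Function.ne_iff.1 (hammingDist_ne_zero.1 h)
    exact ⟨Function.update u i (v i), hammingDist_update_self u v i hi, hammingDist_update u v i hi⟩

/-- Vertices of `K` outside `L` are removed before vertices of `L` are added, so every intermediate
set lies in `K` or in `L` and is a clique. -/
theorem edist_simplexGraph {V : Type*} [DecidableEq V] (G : SimpleGraph V)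
    (K L : {K : Finset V // G.IsClique (K : Set V)}) :
    (simplexGraph G).edist K L = (symmDiff K.1 L.1).card := by
  apply edist_eq_of_descent (δ := fun K L : {K : Finset V // G.IsClique (K : Set V)} =>
    (symmDiff K.1 L.1).card)
  · intro K L; rw [Finset.card_eq_zero, ← Finset.bot_eq_empty, symmDiff_eq_bot, Subtype.ext_iff]
  · intro K M L h
    have h : (symmDiff K.1 M.1).card = 1 := h
    have := (Finset.card_le_card (symmDiff_triangle K.1 M.1 L.1)).trans (Finset.card_union_le _ _)
    omega
  · intro K L h
    by_cases hKL : K.1 ⊆ L.1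
    · obtain ⟨x, hx⟩ := Finset.card_pos.1 (Nat.pos_of_ne_zero h)
      have hx : x ∈ L.1 ∧ x ∉ K.1 := by
        rcases Finset.mem_symmDiff.1 hx with hx | hx
        · exact absurd (hKL hx.1) hx.2
        · exact hx
      refine ⟨⟨insert x K.1, L.2.subset ?_⟩, ?_, ?_⟩
      · exact_mod_cast Finset.insert_subset hx.1 hKL
      · change Finset.card (symmDiff _ _) = 1
        rw [Finset.card_eq_one]
        refine ⟨x, ?_⟩
        ext y
        by_cases hy : y = x
        · subst hy; simp [Finset.mem_symmDiff, hx]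
        · simp [Finset.mem_symmDiff, hy]
      · have : symmDiff (insert x K.1) L.1 = (symmDiff K.1 L.1).erase x := by
          ext y
          by_cases hy : y = x
          · subst hy; simp [Finset.mem_symmDiff, hx]
          · simp [Finset.mem_symmDiff, hy]
        dsimp only
        rw [this]
        exact Finset.card_erase_add_one (by simp [Finset.mem_symmDiff, hx])
    · obtain ⟨x, hxK, hxL⟩ := Finset.not_subset.1 hKL
      refine ⟨⟨K.1.erase x, K.2.subset (by exact_mod_cast Finset.erase_subset _ _)⟩, ?_, ?_⟩
      · change Finset.card (symmDiff _ _) = 1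
        rw [Finset.card_eq_one]
        refine ⟨x, ?_⟩
        ext y
        by_cases hy : y = x
        · subst hy; simp [Finset.mem_symmDiff, hxK]
        · simp [Finset.mem_symmDiff, hy]
      · have : symmDiff (K.1.erase x) L.1 = (symmDiff K.1 L.1).erase x := by
          ext y
          by_cases hy : y = x
          · subst hy; simp [Finset.mem_symmDiff, hxL]
          · simp [Finset.mem_symmDiff, hy]
        dsimp only
        rw [this]
        exact Finset.card_erase_add_one (by simp [Finset.mem_symmDiff, hxK, hxL])

theorem IsFibString.of_le {d : ℕ} {u v : Fin d → Bool} (hv : IsFibString v)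
    (h : ∀ i, u i = true → v i = true) : IsFibString u :=
  fun i j hij hu => hv i j hij ⟨h i hu.1, h j hu.2⟩

/-- Superfluous ones are cleared before missing ones are set, so every intermediate string lies
below `u` or below `v` and is a Fibonacci string. -/
theorem edist_fibonacciCube {d : ℕ} (u v : {u : Fin d → Bool // IsFibString u}) :
    (fibonacciCube d).edist u v = (hammingDist u.1 v.1 : ℕ) := by
  apply edist_eq_of_descent (G := fibonacciCube d)
    (δ := fun u v : {u : Fin d → Bool // IsFibString u} => hammingDist u.1 v.1)
  · intro u v; rw [hammingDist_eq_zero, Subtype.ext_iff]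
  · intro u w v h
    have h : hammingDist u.1 w.1 = 1 := h
    have := hammingDist_triangle u.1 w.1 v.1
    omega
  · intro u v h
    have step : ∀ i, u.1 i ≠ v.1 i → IsFibString (Function.update u.1 i (v.1 i)) →
        ∃ w, (fibonacciCube d).Adj u w ∧ hammingDist w.1 v.1 + 1 = hammingDist u.1 v.1 :=
      fun i hi hfib => ⟨⟨Function.update u.1 i (v.1 i), hfib⟩,
        hammingDist_update_self u.1 v.1 i hi, hammingDist_update u.1 v.1 i hi⟩
    by_cases huv : ∀ i, u.1 i = true → v.1 i = true
    · obtain ⟨i, hi⟩ := Function.ne_iff.1 (hammingDist_ne_zero.1 h)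
      refine step i hi (v.2.of_le fun j hj => ?_)
      by_cases hji : j = i
      · subst hji; simpa using hj
      · exact huv j (by simpa [hji] using hj)
    · push Not at huv
      obtain ⟨i, hu, hv⟩ := huv
      refine step i (by rw [hu]; exact hv.symm) (u.2.of_le fun j hj => ?_)
      by_cases hji : j = i
      · subst hji; exact hu
      · simpa [hji] using hj

theorem IsIsometricEmbedding.hammingDist_eq {V : Type*} {H : SimpleGraph V} {k : ℕ}
    {β : V → Fin k → Bool} (h : IsIsometricEmbedding H (cube k) β) (u v : V) :
    (hammingDist (β u) (β v) : ℕ∞) = H.edist u v := by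
  rw [← h u v, edist_cube]

theorem IsIsometricEmbedding.adj_iff {V : Type*} {H : SimpleGraph V} {k : ℕ}
    {β : V → Fin k → Bool} (h : IsIsometricEmbedding H (cube k) β) (u v : V) :
    H.Adj u v ↔ hammingDist (β u) (β v) = 1 := by
  rw [← SimpleGraph.edist_eq_one_iff_adj, ← h.hammingDist_eq]
  exact_mod_cast Iff.rfl

theorem IsIsometricEmbedding.injective {V W : Type*} {H : SimpleGraph V} {K : SimpleGraph W}
    {φ : V → W} (h : IsIsometricEmbedding H K φ) : Function.Injective φ := by
  intro u v huv
  have := h u v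
  rw [huv, SimpleGraph.edist_self] at this
  exact SimpleGraph.edist_eq_zero_iff.1 this.symm

theorem edist_le_of_adj {V W : Type*} {G : SimpleGraph V} {K : SimpleGraph W} {φ : V → W}
    (h : ∀ u v, G.Adj u v → K.Adj (φ u) (φ v)) (u v : V) :
    K.edist (φ u) (φ v) ≤ G.edist u v := by
  by_cases hT : G.edist u v = ⊤
  · rw [hT]; exact le_top
  · obtain ⟨p, hp⟩ := G.exists_walk_of_edist_ne_top hT
    rw [← hp]
    simpa using (p.map (⟨φ, fun {a b} hab => h a b hab⟩ : G →g K)).edist_le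

theorem edist_iso {V W : Type*} {G : SimpleGraph V} {K : SimpleGraph W} (e : G ≃g K) (u v : V) :
    K.edist (e u) (e v) = G.edist u v := by
  apply le_antisymm (edist_le_of_adj (fun _ _ => e.map_adj_iff.2) u v)
  simpa using edist_le_of_adj (φ := e.symm) (fun _ _ => e.symm.map_adj_iff.2) (e u) (e v)

/-- A map into a Fibonacci cube that reproduces the Hamming distances of an isometric embedding
into a cube is itself isometric. -/
theorem isIsometricEmbedding_fibonacciCube {V : Type*} {H : SimpleGraph V} {k f : ℕ}
    {β : V → Fin k → Bool} (h : IsIsometricEmbedding H (cube k) β)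
    {γ : V → {u : Fin f → Bool // IsFibString u}}
    (hγ : ∀ u v, hammingDist (γ u).1 (γ v).1 = hammingDist (β u) (β v)) :
    IsIsometricEmbedding H (fibonacciCube f) γ := by
  intro u v
  rw [edist_fibonacciCube, hγ, h.hammingDist_eq]

/-! ## Coordinates of isometric embeddings -/

/-- The strings `x` and `y` differ exactly in position `i`. -/
def DiffersAt {d : ℕ} (x y : Fin d → Bool) (i : Fin d) : Prop :=
  ∀ j, y j ≠ x j ↔ j = i

theorem exists_differsAt {d : ℕ} {x y : Fin d → Bool} (h : hammingDist x y = 1) :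
    ∃ i, DiffersAt x y i := by
  obtain ⟨i, hi⟩ := Finset.card_eq_one.1 h
  refine ⟨i, fun j => ?_⟩
  have := Finset.ext_iff.1 hi j
  simpa [eq_comm] using this

theorem DiffersAt.hammingDist_eq {d : ℕ} {x y : Fin d → Bool} {i : Fin d}
    (h : DiffersAt x y i) : hammingDist x y = 1 := by
  rw [hammingDist, Finset.card_eq_one]
  refine ⟨i, ?_⟩
  ext j
  simpa [eq_comm] using h j

/-- The bit of `u` at position `i` is read off from distances alone: it decides which of `x` and `y`
is nearer. This is what makes coordinates an invariant of the metric. -/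
theorem DiffersAt.hammingDist_lt_iff {d : ℕ} {x y : Fin d → Bool} {i : Fin d}
    (h : DiffersAt x y i) (u : Fin d → Bool) :
    hammingDist u y < hammingDist u x ↔ u i ≠ x i := by
  have hyx : ∀ {i}, DiffersAt x y i → Function.update x i (y i) = y := by
    intro i h
    ext j
    by_cases hj : j = i
    · subst hj; simp
    · rw [Function.update_of_ne hj]
      exact (not_not.1 (mt (h j).1 hj)).symm
  have hi : y i ≠ x i := (h i).2 rfl
  by_cases hu : u i = x i
  · have h1 := hammingDist_update y u i (by rw [hu]; exact hi)
    have h2 : Function.update y i (u i) = x := by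
      ext j
      by_cases hj : j = i
      · subst hj; simp [hu]
      · rw [Function.update_of_ne hj]
        exact not_not.1 (mt (h j).1 hj)
    rw [h2, hammingDist_comm x, hammingDist_comm y] at h1
    simp only [hu, ne_eq, not_true_eq_false, iff_false]
    omega
  · have h1 := hammingDist_update x u i (Ne.symm hu)
    have h2 : u i = y i := by
      revert hu hi; cases u i <;> cases x i <;> cases y i <;> simp
    rw [h2, hyx h, hammingDist_comm y, hammingDist_comm x] at h1
    simp only [hu, ne_eq, not_false_eq_true, iff_true]
    omega

/-- Every map that preserves Hamming distances reproduces each coordinate, up to complement, once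
a base point has neighbours in all directions. -/
theorem exists_coordinates {V : Type*} {k f : ℕ} {β : V → Fin k → Bool} {φ : V → Fin f → Bool}
    (hφ : ∀ u v, hammingDist (φ u) (φ v) = hammingDist (β u) (β v)) {r : V} {nb : Fin k → V}
    (hnb : ∀ i, DiffersAt (β r) (β (nb i)) i) :
    ∃ c : Fin k → Fin f, Function.Injective c ∧
      ∀ u i, φ u (c i) ≠ φ r (c i) ↔ β u i ≠ β r i := by
  have : ∀ i, ∃ j, DiffersAt (φ r) (φ (nb i)) j := fun i =>
    exists_differsAt (by rw [hφ]; exact (hnb i).hammingDist_eq)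
  choose c hc using this
  -- Both sides say that `u` is nearer to `nb i` than to `r`, and `φ` preserves these distances.
  have key : ∀ u i, φ u (c i) ≠ φ r (c i) ↔ β u i ≠ β r i := by
    intro u i
    rw [← (hc i).hammingDist_lt_iff, ← (hnb i).hammingDist_lt_iff, hφ, hφ]
  refine ⟨c, fun i j hij => ?_, key⟩
  have h1 := (key (nb i) i).2 ((hnb i i).2 rfl)
  rw [hij] at h1
  exact ((hnb i j).1 ((key (nb i) j).1 h1)).symm

/-- Two coordinates are in conflict (relative to the base point `r`) if some vertex differs from
`r` in both of them. -/
def Conflict {V : Type*} {k : ℕ} (β : V → Fin k → Bool) (r : V) (i j : Fin k) : Prop :=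
  ∃ u, β u i ≠ β r i ∧ β u j ≠ β r j

/-- Consecutive positions used by an isometric embedding into a Fibonacci cube belong to
coordinates without conflict. -/
theorem exists_positions {V : Type*} {H : SimpleGraph V} {k f : ℕ} {β : V → Fin k → Bool}
    (hβ : IsIsometricEmbedding H (cube k) β) {φ : V → {u : Fin f → Bool // IsFibString u}}
    (hφ : IsIsometricEmbedding H (fibonacciCube f) φ) {r : V} {nb : Fin k → V}
    (hnb : ∀ i, DiffersAt (β r) (β (nb i)) i) :
    ∃ c : Fin k → Fin f, Function.Injective c ∧
      ∀ i j, (c j : ℕ) = c i + 1 → ¬ Conflict β r i j := by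
  have hham : ∀ u v, hammingDist (φ u).1 (φ v).1 = hammingDist (β u) (β v) := by
    intro u v
    have h := hβ.hammingDist_eq u v
    rw [← hφ u v, edist_fibonacciCube] at h
    exact_mod_cast h.symm
  obtain ⟨c, hc, key⟩ := exists_coordinates (φ := fun u => (φ u).1) hham hnb
  refine ⟨c, hc, ?_⟩
  rintro i j hij ⟨u, hi, hj⟩
  have hne : i ≠ j := by rintro rfl; omega
  -- Relative to `r`, the vertices `u`, `nb i`, `nb j` and `r` show the four patterns 11, 10, 01 and
  -- 00 at the positions `c i` and `c j`; whatever is complemented, one of them has two consecutive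
  -- ones.
  have e1 := (φ u).2 (c i) (c j) hij
  have e2 := (φ (nb i)).2 (c i) (c j) hij
  have e3 := (φ (nb j)).2 (c i) (c j) hij
  have e4 := (φ r).2 (c i) (c j) hij
  have k1 := (key u i).2 hi
  have k2 := (key u j).2 hj
  have k3 := (key (nb i) i).2 ((hnb i i).2 rfl)
  have k4 := mt (key (nb i) j).1 (not_not.2 (not_not.1 (mt (hnb i j).1 hne.symm)))
  have k5 := (key (nb j) j).2 ((hnb j j).2 rfl)
  have k6 := mt (key (nb j) i).1 (not_not.2 (not_not.1 (mt (hnb j i).1 hne)))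
  revert e1 e2 e3 e4 k1 k2 k3 k4 k5 k6
  generalize (φ u).1 (c i) = a1
  generalize (φ u).1 (c j) = a2
  generalize (φ (nb i)).1 (c i) = a3
  generalize (φ (nb i)).1 (c j) = a4
  generalize (φ (nb j)).1 (c i) = a5
  generalize (φ (nb j)).1 (c j) = a6
  generalize (φ r).1 (c i) = a7
  generalize (φ r).1 (c j) = a8
  revert a1 a2 a3 a4 a5 a6 a7 a8
  decide


/-! ## Simplex graphs -/

/-- The indicator string of a set of vertices. -/
def indicator {m : ℕ} (K : Finset (Fin m)) (i : Fin m) : Bool := decide (i ∈ K)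

theorem hammingDist_indicator {m : ℕ} (K L : Finset (Fin m)) :
    hammingDist (indicator K) (indicator L) = (symmDiff K L).card := by
  rw [hammingDist]
  congr 1
  ext i
  by_cases h1 : i ∈ K <;> by_cases h2 : i ∈ L <;> simp [indicator, Finset.mem_symmDiff, h1, h2]

theorem isIsometricEmbedding_indicator {V : Type*} {H : SimpleGraph V} {m : ℕ}
    {G : SimpleGraph (Fin m)} (e : H ≃g simplexGraph G) :
    IsIsometricEmbedding H (cube m) (fun v => indicator (e v).1) := by
  intro u v
  rw [edist_cube, hammingDist_indicator, ← edist_simplexGraph, edist_iso]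

/-- The isometric dimension of a simplex graph is the number of vertices of the underlying
graph. -/
theorem idim_eq_card {V : Type*} {H : SimpleGraph V} {m k : ℕ}
    {G : SimpleGraph (Fin m)} (e : H ≃g simplexGraph G) (hk : idim H = k)
    {β : V → Fin k → Bool} (hβ : IsIsometricEmbedding H (cube k) β) : m = k := by
  apply le_antisymm
  · have hs : ∀ i : Fin m, G.IsClique (({i} : Finset (Fin m)) : Set (Fin m)) := by
      intro i; simp
    have he : G.IsClique ((∅ : Finset (Fin m)) : Set (Fin m)) := by simp
    -- The empty clique and the singletons serve as base point and neighbours, which makes the `m`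
    -- directions inject into the `k` positions of `β`.
    obtain ⟨c, hc, -⟩ := exists_coordinates (φ := β) (β := fun v => indicator (e v).1)
      (r := e.symm ⟨∅, he⟩) (nb := fun i => e.symm ⟨{i}, hs i⟩)
      (fun u v => by
        have := hβ.hammingDist_eq u v
        rw [← (isIsometricEmbedding_indicator e).hammingDist_eq] at this
        exact_mod_cast this)
      (fun i j => by simp [indicator])
    simpa using Fintype.card_le_of_injective c hc
  · have : idim H ≤ m := iInf₂_le m ⟨_, isIsometricEmbedding_indicator e⟩
    rw [hk] at this
    exact_mod_cast this

/-- A vertex of degree `k` has a neighbour in each of the `k` directions. -/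
theorem exists_neighbours {n k : ℕ} {H : SimpleGraph (Fin n)} [DecidableRel H.Adj]
    {β : Fin n → Fin k → Bool} (hβ : IsIsometricEmbedding H (cube k) β) {r : Fin n}
    (hr : (Finset.univ.filter (H.Adj r)).card = k) :
    ∃ nb : Fin k → Fin n, ∀ i, DiffersAt (β r) (β (nb i)) i := by
  have : ∀ u : Finset.univ.filter (H.Adj r), ∃ i, DiffersAt (β r) (β u) i := fun u =>
    exists_differsAt ((hβ.adj_iff _ _).1 (by have := u.2; rwa [Finset.mem_filter_univ] at this))
  choose d hd using this
  have hinj : Function.Injective d := by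
    intro u v huv
    apply Subtype.ext
    apply hβ.injective
    ext j
    have h1 := hd u j
    have h2 := hd v j
    rw [huv, ← h2] at h1
    revert h1
    cases β u j <;> cases β v j <;> cases β r j <;> simp
  -- Distinct neighbours lie in distinct directions, and there are as many neighbours as directions.
  have hbij : Function.Bijective d :=
    (Fintype.bijective_iff_injective_and_card d).2 ⟨hinj, by rw [Fintype.card_coe, hr, Fintype.card_fin]⟩
  choose nb hnb using hbij.2
  exact ⟨fun i => nb i, fun i => by have := hd (nb i); rwa [hnb] at this⟩

/-- Some vertex has degree `idim H`. -/
theorem exists_root {n k : ℕ} {H : SimpleGraph (Fin n)} [DecidableRel H.Adj]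
    (hH : IsSimplexGraph H) (hk : idim H = k)
    {β : Fin n → Fin k → Bool} (hβ : IsIsometricEmbedding H (cube k) β) :
    ∃ r, (Finset.univ.filter (H.Adj r)).card = k := by
  obtain ⟨m, G, ⟨e⟩⟩ := hH
  obtain rfl := idim_eq_card e hk hβ
  have he : G.IsClique ((∅ : Finset (Fin m)) : Set (Fin m)) := by simp
  refine ⟨e.symm ⟨∅, he⟩, ?_⟩
  have hs : ∀ i : Fin m, G.IsClique (({i} : Finset (Fin m)) : Set (Fin m)) := by
    intro i; simp
  have : Finset.univ.filter (H.Adj (e.symm ⟨∅, he⟩))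
      = Finset.univ.image (fun i => e.symm ⟨{i}, hs i⟩) := by
    ext v
    have : H.Adj (e.symm ⟨∅, he⟩) v ↔ (e v).1.card = 1 := by
      rw [← e.map_adj_iff, RelIso.apply_symm_apply]
      change (symmDiff ∅ (e v).1).card = 1 ↔ _
      rw [← Finset.bot_eq_empty, bot_symmDiff]
    simp only [Finset.mem_filter, Finset.mem_univ, true_and, Finset.mem_image, this,
      Finset.card_eq_one, RelIso.symm_apply_eq, Subtype.ext_iff]
    simp only [eq_comm]
  rw [this, Finset.card_image_of_injective, Finset.card_univ, Fintype.card_fin]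
  intro i j hij
  simpa using hij

/-- Pairwise conflicting coordinates come from a clique, all of whose subsets are vertices. -/
theorem two_pow_card_le {n k : ℕ} {H : SimpleGraph (Fin n)} (hH : IsSimplexGraph H)
    {β : Fin n → Fin k → Bool} (hβ : IsIsometricEmbedding H (cube k) β)
    {r : Fin n} {nb : Fin k → Fin n} (hnb : ∀ i, DiffersAt (β r) (β (nb i)) i)
    {E : Finset (Fin k)} (hE : ∀ i ∈ E, ∀ j ∈ E, i ≠ j → Conflict β r i j) :
    2 ^ E.card ≤ n := by
  obtain ⟨m, G, ⟨e⟩⟩ := hH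
  obtain ⟨c, hc, key⟩ := exists_coordinates (β := β) (φ := fun v => indicator (e v).1)
      (fun u v => by
        have := hβ.hammingDist_eq u v
        rw [← (isIsometricEmbedding_indicator e).hammingDist_eq] at this
        exact_mod_cast this.symm) hnb
  have key' : ∀ u i, (c i ∈ (e u).1 ↔ c i ∈ (e r).1) ↔ β u i = β r i := by
    intro u i
    have := key u i
    rw [← not_iff_not]
    rw [← ne_eq (β u i), ← this]
    simp [indicator]
  have hnb1 : ∀ i, c i ∈ (e (nb i)).1 ↔ c i ∉ (e r).1 := by
    intro i
    have h1 := key' (nb i) i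
    have h2 := (hnb i i).2 rfl
    tauto
  have hnb2 : ∀ i j, j ≠ i → (c j ∈ (e (nb i)).1 ↔ c j ∈ (e r).1) := by
    intro i j hij
    exact (key' (nb i) j).2 (not_not.1 (mt (hnb i j).1 hij))
  -- The base point `r` need not be the empty clique. According to which of `c i`, `c j` already lie
  -- in the clique of `r`, the vertex whose clique contains both is `r`, `nb j`, `nb i` or the
  -- witness of the conflict.
  have hclique : G.IsClique ((E.image c : Finset (Fin m)) : Set (Fin m)) := by
    intro x hx y hy hxy
    obtain ⟨i, hi, rfl⟩ := Finset.mem_image.1 (Finset.mem_coe.1 hx)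
    obtain ⟨j, hj, rfl⟩ := Finset.mem_image.1 (Finset.mem_coe.1 hy)
    have hij : i ≠ j := fun h => hxy (by rw [h])
    have adj : ∀ u, c i ∈ (e u).1 → c j ∈ (e u).1 → G.Adj (c i) (c j) := fun u h1 h2 =>
      (e u).2 (Finset.mem_coe.2 h1) (Finset.mem_coe.2 h2) hxy
    by_cases h1 : c i ∈ (e r).1
    · by_cases h2 : c j ∈ (e r).1
      · exact adj r h1 h2
      · exact adj (nb j) ((hnb2 j i hij).2 h1) ((hnb1 j).2 h2)
    · by_cases h2 : c j ∈ (e r).1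
      · exact adj (nb i) ((hnb1 i).2 h1) ((hnb2 i j hij.symm).2 h2)
      · obtain ⟨u, hu1, hu2⟩ := hE i hi j hj hij
        have k1 := key' u i
        have k2 := key' u j
        exact adj u (by tauto) (by tauto)
  have hsub : ∀ K ∈ (E.image c).powerset, G.IsClique (K : Set (Fin m)) := fun K hK =>
    hclique.subset (by exact_mod_cast Finset.mem_powerset.1 hK)
  have hle := Fintype.card_le_of_injective
    (fun K : (E.image c).powerset => e.symm ⟨K.1, hsub K.1 K.2⟩) (by
      intro K L hKL
      have := e.symm.injective hKL
      exact Subtype.ext (Subtype.mk.inj this))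
  rw [Fintype.card_coe, Fintype.card_fin] at hle
  simpa only [Finset.card_powerset, Finset.card_image_of_injective _ hc] using hle

theorem card_succ_le {n k : ℕ} {β : Fin n → Fin k → Bool} {r : Fin n} {nb : Fin k → Fin n}
    (hnb : ∀ i, DiffersAt (β r) (β (nb i)) i) : k + 1 ≤ n := by
  have hinj : Function.Injective nb := by
    intro i j hij
    have h1 := (hnb i i).2 rfl
    rw [hij] at h1
    exact (hnb j i).1 h1
  have hr : r ∉ Finset.univ.image nb := by
    intro h
    obtain ⟨i, -, hi⟩ := Finset.mem_image.1 h
    have h1 := (hnb i i).2 rfl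
    rw [hi] at h1
    exact h1 rfl
  have := Finset.card_le_univ (insert r (Finset.univ.image nb))
  rw [Finset.card_insert_of_notMem hr, Finset.card_image_of_injective _ hinj] at this
  simpa using this

/-! ## Layouts of coordinates with few breaks -/

/-- The least number of breaks when all elements of `A` are visited after `c`, where `N i j` is
the number of breaks (`0` or `1`) incurred by going from `i` to `j`; `m` is the number of steps. -/
def minBreaksAux (N : ℕ → ℕ → ℕ) : ℕ → Finset ℕ → ℕ → ℕ
  | 0, _, _ => 0
  | m + 1, A, c =>
    if h : A.Nonempty then A.inf' h fun i => N c i + minBreaksAux N m (A.erase i) i else 0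

/-- The least number of breaks when all elements of `A` are visited after `c`. -/
def minBreaks (N : ℕ → ℕ → ℕ) (A : Finset ℕ) (c : ℕ) : ℕ := minBreaksAux N A.card A c

@[simp] theorem minBreaks_empty (N : ℕ → ℕ → ℕ) (c : ℕ) : minBreaks N ∅ c = 0 := rfl

/-- The Held–Karp recursion, freed of the step counter of `minBreaksAux`. -/
theorem minBreaks_eq_inf' (N : ℕ → ℕ → ℕ) {A : Finset ℕ} (h : A.Nonempty) (c : ℕ) :
    minBreaks N A c = A.inf' h fun i => N c i + minBreaks N (A.erase i) i := by
  obtain ⟨m, hm⟩ : ∃ m, A.card = m + 1 := ⟨A.card - 1, by have := h.card_pos; omega⟩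
  unfold minBreaks
  rw [hm, minBreaksAux, dif_pos h]
  apply Finset.inf'_congr h rfl
  intro i hi
  rw [Finset.card_erase_of_mem hi, hm, Nat.add_sub_cancel]

theorem minBreaks_le (N : ℕ → ℕ → ℕ) {A : Finset ℕ} {i : ℕ} (hi : i ∈ A) (c : ℕ) :
    minBreaks N A c ≤ N c i + minBreaks N (A.erase i) i := by
  rw [minBreaks_eq_inf' N ⟨i, hi⟩]
  exact Finset.inf'_le _ hi

theorem minBreaks_eq_of_forall_le (N : ℕ → ℕ → ℕ) {A : Finset ℕ} {i c : ℕ} (hi : i ∈ A)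
    (h : ∀ j ∈ A, N c i + minBreaks N (A.erase i) i ≤ N c j + minBreaks N (A.erase j) j) :
    minBreaks N A c = N c i + minBreaks N (A.erase i) i := by
  apply le_antisymm (minBreaks_le N hi c)
  rw [minBreaks_eq_inf' N ⟨i, hi⟩]
  exact Finset.le_inf' _ _ h

theorem minBreaks_le_card {N : ℕ → ℕ → ℕ} (hN : ∀ i j, N i j ≤ 1) (A : Finset ℕ) (c : ℕ) :
    minBreaks N A c ≤ A.card := by
  induction A using Finset.strongInduction generalizing c with
  | H A ih =>
    rcases A.eq_empty_or_nonempty with rfl | ⟨i, hi⟩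
    · simp
    · have h1 := minBreaks_le N hi c
      have h2 := ih _ (Finset.erase_ssubset hi) i
      have h3 := Finset.card_erase_add_one hi
      have := hN c i
      omega

/-- Lower bound for all placements of `A` into `{l, …, f - 1}` in which consecutive positions
incur no break. -/
theorem card_add_minBreaks_le {N : ℕ → ℕ → ℕ} (hN : ∀ i j, N i j ≤ 1) {f : ℕ} {p : ℕ → ℕ}
    (A : Finset ℕ) (c l : ℕ) (hlf : l ≤ f) (hp : Set.InjOn p A) (hf : ∀ i ∈ A, p i < f)
    (hl : ∀ i ∈ A, l ≤ p i) (hc : ∀ i ∈ A, p i = l → N c i = 0)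
    (hA : ∀ i ∈ A, ∀ j ∈ A, p j = p i + 1 → N i j = 0) :
    A.card + minBreaks N A c + l ≤ f := by
  induction A using Finset.strongInduction generalizing c l with
  | H A ih =>
    rcases A.eq_empty_or_nonempty with rfl | hne
    · simpa using hlf
    · obtain ⟨i, hi, hmin⟩ := A.exists_min_image p hne
      have hsub := Finset.erase_subset i A
      have h2 := ih _ (Finset.erase_ssubset hi) i (p i + 1) (hf i hi)
        (hp.mono (by exact_mod_cast hsub)) (fun j hj => hf j (hsub hj))
        (fun j hj => by
          have h3 := hmin j (hsub hj)
          have h4 : p i ≠ p j := fun h =>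
            (Finset.ne_of_mem_erase hj) (hp (hsub hj) hi h.symm)
          omega)
        (fun j hj h => hA i hi j (hsub hj) h)
        (fun a ha b hb => hA a (hsub ha) b (hsub hb))
      have h1 := minBreaks_le N hi c
      have h3 := Finset.card_erase_add_one hi
      have h4 := hN c i
      have h5 := hl i hi
      have h6 := hc i hi
      -- An element at `l` itself follows `c` without a break; otherwise at least one position is
      -- skipped, which pays for the one break that `N c i` may count.
      by_cases h : p i = l
      · have := h6 h; omega
      · omega

/-! ### Partial and greedy layouts -/

/-- State of a partial layout: the elements of `range k \ A` have got positions below `q`, the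
last of them (if any) being `c` at position `q - 1`. -/
structure IsLayout (N : ℕ → ℕ → ℕ) (k : ℕ) (A : Finset ℕ) (c q : ℕ) (p : ℕ → ℕ) : Prop where
  sub : A ⊆ Finset.range k
  lt : ∀ i < k, i ∉ A → p i < q
  inj : ∀ i < k, i ∉ A → ∀ j < k, j ∉ A → p i = p j → i = j
  last : ∀ i < k, i ∉ A → c < k ∧ c ∉ A ∧ p c + 1 = q
  fib : ∀ i < k, i ∉ A → ∀ j < k, j ∉ A → p j = p i + 1 → N i j = 0

theorem IsLayout.init (N : ℕ → ℕ → ℕ) (k c q : ℕ) (p : ℕ → ℕ) :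
    IsLayout N k (Finset.range k) c q p := by
  constructor <;> simp +contextual

/-- A conflict between `c` and `i` is paid for by one empty position. So the position just before
that of `i` is occupied only if `N c i = 0`, and then, by `last`, it is occupied by `c`. -/
theorem IsLayout.step {N : ℕ → ℕ → ℕ} {k : ℕ} {A : Finset ℕ} {c q : ℕ} {p : ℕ → ℕ}
    (h : IsLayout N k A c q p) {i : ℕ} (hi : i ∈ A) :
    IsLayout N k (A.erase i) i (q + N c i + 1) (Function.update p i (q + N c i)) := by
  have hik : i < k := Finset.mem_range.1 (h.sub hi)
  have hcase : ∀ j < k, j ∉ A.erase i → j = i ∨ (j ≠ i ∧ j ∉ A) := by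
    intro j _ hj
    simp only [Finset.mem_erase, not_and] at hj
    tauto
  constructor
  · exact (Finset.erase_subset i A).trans h.sub
  · intro j hj hjA
    rcases hcase j hj hjA with rfl | ⟨hji, hjB⟩
    · simp
    · rw [Function.update_of_ne hji]; have := h.lt j hj hjB; omega
  · intro j hj hjA l hl hlA heq
    rcases hcase j hj hjA with rfl | ⟨hji, hjB⟩ <;> rcases hcase l hl hlA with rfl | ⟨hli, hlB⟩
    · rfl
    · rw [Function.update_self, Function.update_of_ne hli] at heq
      have := h.lt l hl hlB; omega
    · rw [Function.update_self, Function.update_of_ne hji] at heq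
      have := h.lt j hj hjB; omega
    · rw [Function.update_of_ne hji, Function.update_of_ne hli] at heq
      exact h.inj j hj hjB l hl hlB heq
  · intro j hj hjA
    exact ⟨hik, by simp, by simp⟩
  · intro j hj hjA l hl hlA heq
    rcases hcase j hj hjA with rfl | ⟨hji, hjB⟩ <;> rcases hcase l hl hlA with rfl | ⟨hli, hlB⟩
    · omega
    · rw [Function.update_self, Function.update_of_ne hli] at heq
      have := h.lt l hl hlB; omega
    · rw [Function.update_self, Function.update_of_ne hji] at heq
      have h1 := h.lt j hj hjB
      obtain ⟨hck, hcA, hc⟩ := h.last j hj hjB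
      obtain rfl := h.inj j hj hjB c hck hcA (by omega)
      omega
    · rw [Function.update_of_ne hji, Function.update_of_ne hli] at heq
      exact h.fib j hj hjB l hl hlB heq

/-- State of a greedy layout: the sources of the breaks so far are pairwise in conflict, and also
in conflict with `c` and with all that is still to be placed. -/
structure IsGreedy (N : ℕ → ℕ → ℕ) (k : ℕ) (A : Finset ℕ) (c q : ℕ) (E : Finset ℕ) : Prop where
  mem : A ⊆ Finset.range k
  cur : c = k ∨ c < k ∧ c ∉ A
  sub : E ⊆ Finset.range k
  card : E.card + k = q + A.card
  disj : ∀ i ∈ E, i ∉ A ∧ i ≠ c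
  left : ∀ i ∈ E, N i c = 1
  next : ∀ i ∈ E, ∀ j ∈ A, N i j = 1
  pair : ∀ i ∈ E, ∀ j ∈ E, i ≠ j → N i j = 1

/-- The value `k` is not a coordinate but a virtual start. -/
theorem IsGreedy.init (N : ℕ → ℕ → ℕ) (k : ℕ) :
    IsGreedy N k (Finset.range k) k 0 ∅ := by
  constructor <;> simp

/-- If even the cheapest step is a break, then `c` conflicts with all of `A` and may join the
sources of breaks; its conflicts with the earlier sources were recorded in `left`. The virtual start
`k` never causes a break, so only genuine coordinates join. -/
theorem IsGreedy.step {N : ℕ → ℕ → ℕ} {k : ℕ} (hN : ∀ i j, N i j ≤ 1) (hNk : ∀ j, N k j = 0)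
    (hsymm : ∀ i < k, ∀ j < k, N i j = N j i) {A : Finset ℕ} {c q : ℕ} {E : Finset ℕ}
    (h : IsGreedy N k A c q E) {i : ℕ} (hi : i ∈ A) (hmin : ∀ j ∈ A, N c i ≤ N c j) :
    ∃ E', IsGreedy N k (A.erase i) i (q + N c i + 1) E' := by
  have hcard := Finset.card_erase_add_one hi
  have h1 := h.card
  have hmem := (Finset.erase_subset i A).trans h.mem
  have hcur : i = k ∨ i < k ∧ i ∉ A.erase i := Or.inr ⟨Finset.mem_range.1 (h.mem hi), by simp⟩
  rcases Nat.eq_zero_or_pos (N c i) with h0 | h0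
  · refine ⟨E, hmem, hcur, h.sub, by omega, fun j hj => ⟨?_, ?_⟩, fun j hj => h.next j hj i hi,
      fun j hj l hl => h.next j hj l (Finset.mem_of_mem_erase hl), h.pair⟩
    · exact fun hjA => (h.disj j hj).1 (Finset.mem_of_mem_erase hjA)
    · rintro rfl; exact (h.disj j hj).1 hi
  · have hone : ∀ j ∈ A, N c j = 1 := fun j hj => by
      have := hmin j hj; have := hN c j; omega
    obtain ⟨hck, hcA⟩ : c < k ∧ c ∉ A := by
      rcases h.cur with rfl | hc
      · rw [hNk] at h0; omega
      · exact hc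
    have hcE : c ∉ E := fun hc => (h.disj c hc).2 rfl
    have hci : c ≠ i := by rintro rfl; exact hcA hi
    refine ⟨insert c E, hmem, hcur, ?_, ?_, ?_, ?_, ?_, ?_⟩
    · exact Finset.insert_subset (Finset.mem_range.2 hck) h.sub
    · rw [Finset.card_insert_of_notMem hcE]; have := hN c i; omega
    · intro j hj
      rcases Finset.mem_insert.1 hj with rfl | hj
      · exact ⟨fun h => hcA (Finset.mem_of_mem_erase h), hci⟩
      · exact ⟨fun hjA => (h.disj j hj).1 (Finset.mem_of_mem_erase hjA), by
          rintro rfl; exact (h.disj j hj).1 hi⟩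
    · intro j hj
      rcases Finset.mem_insert.1 hj with rfl | hj
      · exact hone i hi
      · exact h.next j hj i hi
    · intro j hj l hl
      rcases Finset.mem_insert.1 hj with rfl | hj
      · exact hone l (Finset.mem_of_mem_erase hl)
      · exact h.next j hj l (Finset.mem_of_mem_erase hl)
    · intro j hj l hl hjl
      rcases Finset.mem_insert.1 hj with rfl | hj' <;>
        rcases Finset.mem_insert.1 hl with rfl | hl'
      · exact absurd rfl hjl
      · rw [hsymm _ hck _ (Finset.mem_range.1 (h.sub hl'))]; exact h.left l hl'
      · exact h.left j hj'
      · exact h.pair j hj' l hl' hjl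

/-! ## Reasoning about programs -/

/-- Machine states in which only the first registers and memory banks are in use. -/
@[ext] structure Config where
  n : ℕ
  k : ℕ
  r : ℕ
  cur : ℕ
  q : ℕ
  S : ℕ
  bc : ℕ
  bi : ℕ
  x : ℕ
  a : ℕ
  u : ℕ
  i : ℕ
  c : ℕ
  t : ℕ
  m0 : ℕ → ℕ
  m1 : ℕ → ℕ
  m2 : ℕ → ℕ
  m3 : ℕ → ℕ
  m4 : ℕ → ℕ
  m5 : ℕ → ℕ
  m6 : ℕ → ℕ
  m7 : ℕ → ℕ

namespace Config

/-- The contents of the registers. -/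
@[simp] def regs (s : Config) : ℕ → ℕ
  | 0 => s.n
  | 1 => s.k
  | 2 => s.r
  | 3 => s.cur
  | 4 => s.q
  | 5 => s.S
  | 6 => s.bc
  | 7 => s.bi
  | 8 => s.x
  | 9 => s.a
  | 10 => s.u
  | 11 => s.i
  | 12 => s.c
  | 13 => s.t
  | _ => 0

/-- The contents of the memory. -/
@[simp] def banks (s : Config) : ℕ → ℕ → ℕ
  | 0 => s.m0
  | 1 => s.m1
  | 2 => s.m2
  | 3 => s.m3
  | 4 => s.m4
  | 5 => s.m5
  | 6 => s.m6
  | 7 => s.m7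
  | _ => fun _ => 0

/-- The machine state of a configuration. -/
@[simp] def st (s : Config) : State := ⟨s.regs, s.banks⟩

/-- Writing to a register. -/
@[simp] def setReg (s : Config) (x v : ℕ) : Config :=
  match x with
  | 0 => { s with n := v }
  | 1 => { s with k := v }
  | 2 => { s with r := v }
  | 3 => { s with cur := v }
  | 4 => { s with q := v }
  | 5 => { s with S := v }
  | 6 => { s with bc := v }
  | 7 => { s with bi := v }
  | 8 => { s with x := v }
  | 9 => { s with a := v }
  | 10 => { s with u := v }
  | 11 => { s with i := v }
  | 12 => { s with c := v }
  | 13 => { s with t := v }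
  | _ => s

/-- Replacing a memory bank. -/
@[simp] def setBank (s : Config) (b : ℕ) (f : ℕ → ℕ) : Config :=
  match b with
  | 2 => { s with m2 := f }
  | 3 => { s with m3 := f }
  | 4 => { s with m4 := f }
  | 5 => { s with m5 := f }
  | 6 => { s with m6 := f }
  | 7 => { s with m7 := f }
  | _ => s

theorem st_setReg (s : Config) {x : ℕ} (hx : x < 14) (v : ℕ) :
    (s.setReg x v).st = { s.st with reg := Function.update s.st.reg x v } := by
  have : (s.setReg x v).banks = s.banks := by
    interval_cases x <;> rfl
  refine congrArg₂ State.mk ?_ this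
  funext y
  by_cases hy : y = x
  · subst hy
    rw [Function.update_self]
    interval_cases y <;> rfl
  · rw [Function.update_of_ne hy]
    change (s.setReg x v).regs y = s.regs y
    interval_cases x <;> (unfold regs setReg; split <;> first | rfl | exact absurd rfl hy)

theorem st_setBank (s : Config) {b : ℕ} (hb : 2 ≤ b ∧ b < 8) (f : ℕ → ℕ) :
    (s.setBank b f).st = { s.st with mem := Function.update s.st.mem b f } := by
  obtain ⟨hb2, hb8⟩ := hb
  have : (s.setBank b f).regs = s.regs := by
    interval_cases b <;> rfl
  refine congrArg₂ State.mk this ?_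
  funext y
  by_cases hy : y = b
  · subst hy
    rw [Function.update_self]
    interval_cases y <;> rfl
  · rw [Function.update_of_ne hy]
    change (s.setBank b f).banks y = s.banks y
    interval_cases b <;> (unfold banks setBank; split <;> first | rfl | exact absurd rfl hy)

end Config

/-- The program `p`, started in `s`, halts within `T` steps in a configuration satisfying `Q`. -/
def Runs (B : ℕ) (p : Cmd) (s : Config) (T : ℕ) (Q : Config → Prop) : Prop :=
  ∃ t s', Exec B p s.st t (Config.st s') ∧ t ≤ T ∧ Q s'

namespace Runs

variable {B : ℕ} {p q : Cmd} {s : Config} {T T₁ T₂ : ℕ} {Q R : Config → Prop} {e e' : Expr}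

theorem mono (h : Runs B p s T₁ R) (hT : T₁ ≤ T) (hQ : ∀ s', R s' → Q s') : Runs B p s T Q := by
  obtain ⟨t, s', he, ht, hR⟩ := h
  exact ⟨t, s', he, ht.trans hT, hQ _ hR⟩

theorem nop (hQ : Q s) (hT : 1 ≤ T) : Runs B .nop s T Q := ⟨1, s, .nop _, hT, hQ⟩

theorem seq (h₁ : Runs B p s T₁ R) (h₂ : ∀ s', R s' → Runs B q s' T₂ Q) (hT : T₁ + T₂ ≤ T) :
    Runs B (.seq p q) s T Q := by
  obtain ⟨t, s', he, ht, hR⟩ := h₁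
  obtain ⟨t', s'', he', ht', hQ⟩ := h₂ _ hR
  exact ⟨t + t', s'', .seq he he', by omega, hQ⟩

theorem assign {x : ℕ} (hx : x < 14) (he : e.Fits B s.st) (hT : e.cost + 1 ≤ T)
    (hQ : Q (s.setReg x (e.eval s.st))) : Runs B (.assign x e) s T Q :=
  ⟨_, _, by rw [s.st_setReg hx]; exact .assign he, hT, hQ⟩

theorem assign_seq {x : ℕ} (hx : x < 14) (he : e.Fits B s.st)
    (h : Runs B p (s.setReg x (e.eval s.st)) T₂ Q) (hT : e.cost + 1 + T₂ ≤ T) :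
    Runs B (.seq (.assign x e) p) s T Q :=
  (assign (Q := (· = _)) hx he le_rfl rfl).seq (by rintro _ rfl; exact h) hT

theorem store {b : ℕ} (hb : 2 ≤ b ∧ b < 8) (he : e.Fits B s.st) (he' : e'.Fits B s.st)
    (hT : e.cost + e'.cost + 1 ≤ T)
    (hQ : Q (s.setBank b (Function.update (s.st.mem b) (e.eval s.st) (e'.eval s.st)))) :
    Runs B (.store b e e') s T Q :=
  ⟨_, _, by rw [s.st_setBank hb]; exact .store he he', hT, hQ⟩

theorem store_seq {b : ℕ} (hb : 2 ≤ b ∧ b < 8) (he : e.Fits B s.st) (he' : e'.Fits B s.st)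
    (h : Runs B p (s.setBank b (Function.update (s.st.mem b) (e.eval s.st) (e'.eval s.st))) T₂ Q)
    (hT : e.cost + e'.cost + 1 + T₂ ≤ T) : Runs B (.seq (.store b e e') p) s T Q :=
  (store (Q := (· = _)) hb he he' le_rfl rfl).seq (by rintro _ rfl; exact h) hT

theorem cond (he : e.Fits B s.st) (h₁ : e.eval s.st ≠ 0 → Runs B p s T₁ Q)
    (h₂ : e.eval s.st = 0 → Runs B q s T₁ Q) (hT : e.cost + 1 + T₁ ≤ T) :
    Runs B (.cond e p q) s T Q := by
  by_cases h : e.eval s.st = 0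
  · obtain ⟨t, s', he', ht, hQ⟩ := h₂ h
    exact ⟨_, s', .cond_false he h he', by omega, hQ⟩
  · obtain ⟨t, s', he', ht, hQ⟩ := h₁ h
    exact ⟨_, s', .cond_true he h he', by omega, hQ⟩

/-- A loop that is run through `N` times, with an invariant. -/
theorem loop {N : ℕ} (Inv : ℕ → Config → Prop)
    (hstep : ∀ j < N, ∀ s, Inv j s →
      e.Fits B s.st ∧ e.eval s.st ≠ 0 ∧ Runs B p s T₁ (Inv (j + 1)))
    (hdone : ∀ s, Inv N s → e.Fits B s.st ∧ e.eval s.st = 0)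
    (h0 : Inv 0 s) (hT : N * (e.cost + 1 + T₁) + (e.cost + 1) ≤ T) :
    Runs B (.loop e p) s T (Inv N) := by
  suffices H : ∀ m ≤ N, ∀ s, Inv (N - m) s →
      Runs B (.loop e p) s (m * (e.cost + 1 + T₁) + (e.cost + 1)) (Inv N) from
    (H N le_rfl s (by simpa using h0)).mono hT (fun _ h => h)
  intro m
  induction m with
  | zero =>
    intro _ s hs
    obtain ⟨hf, hv⟩ := hdone s hs
    exact ⟨_, s, .loop_done hf hv, by omega, hs⟩
  | succ m ih =>
    intro hm s hs
    obtain ⟨hf, hv, t, s', he, ht, hI⟩ := hstep _ (by omega) s hs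
    rw [show N - (m + 1) + 1 = N - m by omega] at hI
    obtain ⟨t', s'', he', ht', hQ⟩ := ih (by omega) s' hI
    exact ⟨_, s'', .loop_step hf hv he he', by rw [Nat.succ_mul]; omega, hQ⟩

end Runs

/-- `forLoop x e p` runs `p` for all values of register `x` from `0` on and below that of `e`. -/
def forLoop (x : ℕ) (e : Expr) (p : Cmd) : Cmd :=
  .seq (.assign x (.lit 0)) (.loop (.bin .lt (.reg x) e)
    (.seq p (.assign x (.bin .add (.reg x) (.lit 1)))))

/-- The invariant has to pin down both the counter and the value of the bound, since the body may
change registers and memory. Each pass pays `e.cost + 3` for the test and `4` for the increment; the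
extra factor `N + 1` covers the initialisation and the last test. -/
theorem Runs.forLoop {B N : ℕ} {p : Cmd} {s : Config} {T T₁ : ℕ} {e : Expr} {x : ℕ}
    (hx : x < 14) (Inv : ℕ → Config → Prop) (hNB : N + 1 < B)
    (hreg : ∀ j ≤ N, ∀ s, Inv j s → s.regs x = j ∧ e.Fits B s.st ∧ e.eval s.st = N)
    (hstep : ∀ j < N, ∀ s, Inv j s →
      Runs B p s T₁ (fun s' => s'.regs x = j ∧ Inv (j + 1) (s'.setReg x (j + 1))))
    (h0 : Inv 0 (s.setReg x 0)) (hT : (N + 1) * (e.cost + 7 + T₁) ≤ T) :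
    Runs B (forLoop x e p) s T (Inv N) := by
  have hfits : ∀ j ≤ N, ∀ s, Inv j s → (Expr.bin .lt (.reg x) e).Fits B s.st ∧
      (Expr.bin .lt (.reg x) e).eval s.st = if j < N then 1 else 0 := by
    intro j hj s hs
    obtain ⟨h1, h2, h3⟩ := hreg j hj s hs
    have h1 : s.st.reg x = j := h1
    simp only [Expr.Fits, Expr.eval, Op.apply, h1, h3, h2]
    refine ⟨⟨by omega, trivial, ?_⟩, trivial⟩
    split <;> omega
  refine Runs.assign_seq hx (show 0 < B by omega) (T₂ := N * (e.cost + 7 + T₁) + (e.cost + 3))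
    (Runs.loop (T₁ := T₁ + 4) Inv ?_ ?_ h0 ?_) ?_
  · intro j hj s hs
    obtain ⟨hf, hv⟩ := hfits j hj.le s hs
    refine ⟨hf, by rw [hv, if_pos hj]; exact one_ne_zero, ?_⟩
    refine (hstep j hj s hs).seq (T₂ := 4) (fun s' hs' => ?_) le_rfl
    have h1 : s'.st.reg x = j := hs'.1
    refine Runs.assign hx ?_ (by simp [Expr.cost]) ?_
    · simp only [Expr.Fits, Expr.eval, Op.apply, h1]
      omega
    · simp only [Expr.eval, Op.apply, h1]
      exact hs'.2
  · intro s hs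
    have := hfits N le_rfl s hs
    simpa using this
  · simp only [Expr.cost]
    exact le_of_eq (by ring)
  · simp only [Expr.cost]
    rw [Nat.succ_mul] at hT
    omega


/-! ### Rules for evaluation, overflow and cost of expressions -/

theorem Expr.Fits.eval_lt {B : ℕ} {s : State} {e : Expr} (h : e.Fits B s) : e.eval s < B := by
  cases e with
  | lit c => exact h
  | reg x => exact h
  | load b e => exact h.2
  | bin o e₁ e₂ => exact h.2.2

namespace Expr

instance : Add Expr := ⟨bin .add⟩
instance : Sub Expr := ⟨bin .sub⟩
instance : Mul Expr := ⟨bin .mul⟩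
instance : Div Expr := ⟨bin .div⟩
instance : Mod Expr := ⟨bin .mod⟩

section

variable (s : State) (B : ℕ) (e₁ e₂ : Expr)

@[simp] theorem eval_add : (e₁ + e₂).eval s = e₁.eval s + e₂.eval s := rfl
@[simp] theorem eval_sub : (e₁ - e₂).eval s = e₁.eval s - e₂.eval s := rfl
@[simp] theorem eval_mul : (e₁ * e₂).eval s = e₁.eval s * e₂.eval s := rfl
@[simp] theorem eval_div : (e₁ / e₂).eval s = e₁.eval s / e₂.eval s := rfl
@[simp] theorem eval_mod : (e₁ % e₂).eval s = e₁.eval s % e₂.eval s := rfl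
@[simp] theorem eval_lt : (bin .lt e₁ e₂).eval s = if e₁.eval s < e₂.eval s then 1 else 0 := rfl
@[simp] theorem eval_eq : (bin .eq e₁ e₂).eval s = if e₁.eval s = e₂.eval s then 1 else 0 := rfl
@[simp] theorem eval_lit (c : ℕ) : (lit c).eval s = c := rfl
@[simp] theorem eval_reg (x : ℕ) : (reg x).eval s = s.reg x := rfl
@[simp] theorem eval_load (b : ℕ) : (load b e₁).eval s = s.mem b (e₁.eval s) := rfl

@[simp] theorem fits_add : (e₁ + e₂).Fits B s ↔
    e₁.Fits B s ∧ e₂.Fits B s ∧ e₁.eval s + e₂.eval s < B := Iff.rfl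
@[simp] theorem fits_mul : (e₁ * e₂).Fits B s ↔
    e₁.Fits B s ∧ e₂.Fits B s ∧ e₁.eval s * e₂.eval s < B := Iff.rfl
-- Differences, quotients and remainders never exceed their first operand, hence cannot overflow.
@[simp] theorem fits_sub : (e₁ - e₂).Fits B s ↔ e₁.Fits B s ∧ e₂.Fits B s :=
  ⟨fun h => ⟨h.1, h.2.1⟩, fun h => ⟨h.1, h.2, (Nat.sub_le _ _).trans_lt h.1.eval_lt⟩⟩
@[simp] theorem fits_div : (e₁ / e₂).Fits B s ↔ e₁.Fits B s ∧ e₂.Fits B s :=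
  ⟨fun h => ⟨h.1, h.2.1⟩, fun h => ⟨h.1, h.2, (Nat.div_le_self _ _).trans_lt h.1.eval_lt⟩⟩
@[simp] theorem fits_mod : (e₁ % e₂).Fits B s ↔ e₁.Fits B s ∧ e₂.Fits B s :=
  ⟨fun h => ⟨h.1, h.2.1⟩, fun h => ⟨h.1, h.2, (Nat.mod_le _ _).trans_lt h.1.eval_lt⟩⟩
@[simp] theorem fits_lt : (bin .lt e₁ e₂).Fits B s ↔ e₁.Fits B s ∧ e₂.Fits B s ∧
    (if e₁.eval s < e₂.eval s then 1 else 0) < B := Iff.rfl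
@[simp] theorem fits_eq : (bin .eq e₁ e₂).Fits B s ↔ e₁.Fits B s ∧ e₂.Fits B s ∧
    (if e₁.eval s = e₂.eval s then 1 else 0) < B := Iff.rfl
@[simp] theorem fits_lit (c : ℕ) : (lit c).Fits B s ↔ c < B := Iff.rfl
@[simp] theorem fits_reg (x : ℕ) : (reg x).Fits B s ↔ s.reg x < B := Iff.rfl
@[simp] theorem fits_load (b : ℕ) : (load b e₁).Fits B s ↔
    e₁.Fits B s ∧ s.mem b (e₁.eval s) < B := Iff.rfl

@[simp] theorem cost_add : (e₁ + e₂).cost = e₁.cost + e₂.cost + 1 := rfl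
@[simp] theorem cost_sub : (e₁ - e₂).cost = e₁.cost + e₂.cost + 1 := rfl
@[simp] theorem cost_mul : (e₁ * e₂).cost = e₁.cost + e₂.cost + 1 := rfl
@[simp] theorem cost_div : (e₁ / e₂).cost = e₁.cost + e₂.cost + 1 := rfl
@[simp] theorem cost_mod : (e₁ % e₂).cost = e₁.cost + e₂.cost + 1 := rfl
@[simp] theorem cost_bin (o : Op) : (bin o e₁ e₂).cost = e₁.cost + e₂.cost + 1 := rfl
@[simp] theorem cost_lit (c : ℕ) : (lit c).cost = 1 := rfl
@[simp] theorem cost_reg (x : ℕ) : (reg x).cost = 1 := rfl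
@[simp] theorem cost_load (b : ℕ) : (load b e₁).cost = e₁.cost + 1 := rfl

end

end Expr

/-! ## The program -/

/-- Finds a vertex of degree `k`. -/
def rootCmd : Cmd :=
  forLoop 9 (.reg 0) (.seq (.assign 12 (.lit 0)) (.seq
    (forLoop 10 (.reg 0) (.assign 12 (.reg 12 + .load 1 (.reg 9 * .reg 0 + .reg 10))))
    (.cond (.bin .eq (.reg 12) (.reg 1)) (.assign 2 (.reg 9)) .nop)))

theorem mul_add_lt {i j n k : ℕ} (hi : i < n) (hj : j < k) : i * k + j < n * k := by
  nlinarith [Nat.mul_le_mul_right k (Nat.succ_le_of_lt hi)]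

theorem ite_one_zero_le (p : Prop) [Decidable p] : (if p then 1 else 0) ≤ 1 := by
  split <;> omega

/-- A vertex degree is a row sum of the adjacency table. Later vertices of the right degree
overwrite earlier ones, so the invariant only asserts that register `r` is correct once some
candidate has been passed. -/
theorem runs_rootCmd {B : ℕ} {s : Config} (hB : (s.n + 2) * (s.n + 2) ≤ B) (hk : s.k < B)
    (hm : ∀ j, s.m1 j ≤ 1)
    (hr : ∃ v < s.n, ∑ u ∈ Finset.range s.n, s.m1 (v * s.n + u) = s.k) :
    Runs B rootCmd s (40 * ((s.n + 1) * (s.n + 1))) fun s' => ∃ r a u c,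
      s' = { s with r := r, a := a, u := u, c := c } ∧ r < s.n ∧
        ∑ u ∈ Finset.range s.n, s.m1 (r * s.n + u) = s.k := by
  have hnB : s.n * s.n + 4 * s.n + 4 ≤ B := by nlinarith
  refine (Runs.forLoop (by norm_num) (N := s.n) (T₁ := 17 * (s.n + 1) + 10)
    (Inv := fun j s' => ∃ r u c, s' = { s with r := r, a := j, u := u, c := c } ∧
      ((∃ v < j, ∑ u ∈ Finset.range s.n, s.m1 (v * s.n + u) = s.k) →
        r < s.n ∧ ∑ u ∈ Finset.range s.n, s.m1 (r * s.n + u) = s.k))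
    (by omega) ?_ ?_ ?_ ?_).mono le_rfl ?_
  · rintro j hj _ ⟨r, u, c, rfl, -⟩
    simp
    omega
  · rintro j hj _ ⟨r, u, c, rfl, h⟩
    refine Runs.assign_seq (T₂ := 17 * (s.n + 1) + 8) (by norm_num) (by simp; omega) ?_ (by simp; omega)
    refine Runs.seq (T₁ := 17 * (s.n + 1)) (T₂ := 8) (Runs.forLoop (by norm_num) (N := s.n) (T₁ := 9)
      (Inv := fun l s' => s' = { s with
        r := r, a := j, u := l
        c := ∑ u ∈ Finset.range l, s.m1 (j * s.n + u) }) (by omega) ?_ ?_ ?_ ?_) ?_ ?_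
    · rintro l hl _ rfl
      simp
      omega
    · rintro l hl _ rfl
      have h1 := mul_add_lt hj hl
      have h2 : ∑ u ∈ Finset.range l, s.m1 (j * s.n + u) ≤ l := by
        simpa using Finset.sum_le_sum (s := Finset.range l) (fun u _ => hm (j * s.n + u))
      have h3 := hm (j * s.n + l)
      refine Runs.assign (by norm_num) ?_ (by simp) ?_
      · simp
        omega
      · simp [Finset.sum_range_succ]
    · simp
    · simp
      omega
    · rintro _ rfl
      have h2 : ∑ u ∈ Finset.range s.n, s.m1 (j * s.n + u) ≤ s.n := by
        simpa using Finset.sum_le_sum (s := Finset.range s.n) (fun u _ => hm (j * s.n + u))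
      have h3 := ite_one_zero_le (∑ u ∈ Finset.range s.n, s.m1 (j * s.n + u) = s.k)
      refine Runs.cond (T₁ := 4) ?_ (fun hv => ?_) (fun hv => ?_) (by simp)
      · simp
        omega
      · refine Runs.assign (by norm_num) ?_ (by simp) ?_
        · simp; omega
        · simp at hv
          simp [hj, hv]
      · refine Runs.nop ?_ (by norm_num)
        simp at hv
        refine ⟨by simp, _, _, _, rfl, ?_⟩
        rintro ⟨v, hvj, hvk⟩
        rcases Nat.lt_succ_iff_lt_or_eq.1 hvj with hvj | rfl
        · exact h ⟨v, hvj, hvk⟩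
        · exact absurd hvk hv
    · omega
  · exact ⟨_, _, _, rfl, by simp⟩
  · simp
    ring_nf
    nlinarith
  · rintro _ ⟨r, u, c, rfl, h⟩
    exact ⟨_, _, _, _, rfl, h hr⟩

/-! ### The conflict table -/

/-- Whether the strings of vertices `u` and `r` differ at position `i` (as `0` or `1`). -/
def bitDiff (m : ℕ → ℕ) (k r u i : ℕ) : ℕ := (m (u * k + i) + m (r * k + i)) % 2

theorem bitDiff_lt (m : ℕ → ℕ) (k r u i : ℕ) : bitDiff m k r u i < 2 := Nat.mod_lt _ (by norm_num)

/-- Computes `bitDiff`, the root being in register `2`. -/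
def bitDiffExpr (u i : Expr) : Expr :=
  (.load 0 (u * .reg 1 + i) + .load 0 (.reg 2 * .reg 1 + i)) % .lit 2

@[simp] theorem eval_bitDiffExpr (s : Config) (u i : Expr) : (bitDiffExpr u i).eval ⟨s.regs, s.banks⟩ =
    bitDiff s.m0 s.k s.r (u.eval ⟨s.regs, s.banks⟩) (i.eval ⟨s.regs, s.banks⟩) := rfl

@[simp] theorem cost_bitDiffExpr (u i : Expr) :
    (bitDiffExpr u i).cost = u.cost + 2 * i.cost + 12 := by
  simp [bitDiffExpr]
  ring

theorem fits_bitDiffExpr {B : ℕ} {s : Config} {u i : Expr} (hB : s.n * s.k + s.n + s.k + 3 ≤ B)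
    (hm : ∀ j, s.m0 j ≤ 1) (hr : s.r < s.n) (hu : u.Fits B s.st) (hu' : u.eval s.st < s.n)
    (hi : i.Fits B s.st) (hi' : i.eval s.st < s.k) : (bitDiffExpr u i).Fits B s.st := by
  have h1 := mul_add_lt hu' hi'
  have h2 := mul_add_lt hr hi'
  have h3 := hm (u.eval s.st * s.k + i.eval s.st)
  have h4 := hm (s.r * s.k + i.eval s.st)
  simp only [Config.st] at h1 h2 h3 h4 hu hi
  simp [bitDiffExpr, hu, hi]
  omega

/-- Tabulates which pairs of coordinates are in conflict. -/
def conflictCmd : Cmd :=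
  forLoop 9 (.reg 1 * .reg 1) (.seq (.assign 12 (.lit 0)) (.seq
    (forLoop 10 (.reg 0) (.cond
      (bitDiffExpr (.reg 10) (.reg 9 / .reg 1) * bitDiffExpr (.reg 10) (.reg 9 % .reg 1))
      (.assign 12 (.lit 1)) .nop))
    (.store 3 (.reg 9) (.reg 12))))

/-- The table computed by `conflictCmd`. -/
def conflictTable (m : ℕ → ℕ) (n k r a : ℕ) : ℕ :=
  if a < k * k ∧ ∃ u < n, bitDiff m k r u (a / k) = 1 ∧ bitDiff m k r u (a % k) = 1 then 1 else 0

/-- A single counter runs over all pairs of coordinates, decoded by quotient and remainder modulo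
`k`; the product of the two difference bits is their conjunction. -/
theorem runs_conflictCmd {B : ℕ} {s : Config}
    (hB : s.n * s.k + s.k * s.k + s.n + s.k + 3 ≤ B) (hm : ∀ j, s.m0 j ≤ 1) (hr : s.r < s.n)
    (h3 : s.m3 = fun _ => 0) :
    Runs B conflictCmd s (100 * ((s.k * s.k + 1) * (s.n + 1))) fun s' => ∃ a u c,
      s' = { s with a := a, u := u, c := c, m3 := conflictTable s.m0 s.n s.k s.r } := by
  refine (Runs.forLoop (by norm_num) (N := s.k * s.k) (T₁ := 50 * (s.n + 1) + 10)
    (Inv := fun j s' => ∃ u c m, s' = { s with a := j, u := u, c := c, m3 := m } ∧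
      m = fun a => if a < j then conflictTable s.m0 s.n s.k s.r a else 0)
    (by omega) ?_ ?_ ?_ ?_).mono le_rfl ?_
  · rintro j hj _ ⟨u, c, m, rfl, hm3⟩
    simp
    omega
  · rintro j hj _ ⟨u, c, m, rfl, hm3⟩
    have hk : 0 < s.k := Nat.pos_of_ne_zero (by rintro h; simp [h] at hj)
    have hdiv : j / s.k < s.k := Nat.div_lt_of_lt_mul hj
    have hmod : j % s.k < s.k := Nat.mod_lt _ hk
    refine Runs.assign_seq (T₂ := 50 * (s.n + 1) + 8) (by norm_num) (by simp; omega) ?_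
      (by simp; omega)
    refine Runs.seq (T₁ := 50 * (s.n + 1)) (T₂ := 8) (Runs.forLoop (by norm_num) (N := s.n)
      (T₁ := 42) (Inv := fun l s' => s' = { s with
        a := j, u := l
        c := if ∃ u < l, bitDiff s.m0 s.k s.r u (j / s.k) = 1 ∧
          bitDiff s.m0 s.k s.r u (j % s.k) = 1 then 1 else 0
        m3 := m })
      (by omega) ?_ ?_ ?_ ?_) ?_ ?_
    · rintro l hl _ rfl
      simp
      omega
    · rintro l hl _ rfl
      have h1 := bitDiff_lt s.m0 s.k s.r l (j / s.k)
      have h2 := bitDiff_lt s.m0 s.k s.r l (j % s.k)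
      refine Runs.cond (T₁ := 2) ?_ (fun hv => ?_) (fun hv => ?_) (by simp)
      · rw [Expr.fits_mul]
        refine ⟨fits_bitDiffExpr (by simp; omega) hm hr (by simp; omega) hl (by simp; omega) hdiv,
          fits_bitDiffExpr (by simp; omega) hm hr (by simp; omega) hl (by simp; omega) hmod, ?_⟩
        simp
        nlinarith
      · refine Runs.assign (by norm_num) (by simp; omega) (by simp) ?_
        simp at hv
        simp
        exact ⟨l, le_rfl, by omega, by omega⟩
      · refine Runs.nop ?_ (by norm_num)
        simp at hv
        simp
        congr 1
        apply propext
        constructor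
        · rintro ⟨u, hu, h⟩
          exact ⟨u, by omega, h⟩
        · rintro ⟨u, hu, h⟩
          rcases Nat.lt_or_eq_of_le hu with hu | rfl
          · exact ⟨u, hu, h⟩
          · omega
    · simp
    · simp
      omega
    · rintro _ rfl
      refine Runs.store (by norm_num) ?_ ?_ (by simp) ?_
      · simp; omega
      · simp
        have := ite_one_zero_le (∃ u < s.n, bitDiff s.m0 s.k s.r u (j / s.k) = 1 ∧
          bitDiff s.m0 s.k s.r u (j % s.k) = 1)
        omega
      · refine ⟨rfl, _, _, _, rfl, ?_⟩
        funext a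
        by_cases ha : a = j
        · subst ha
          simp [conflictTable, hj]
        · simp [ha, hm3, show a < j + 1 ↔ a < j by omega]
    · omega
  · exact ⟨_, _, _, rfl, by simp [h3]⟩
  · simp
    ring_nf
    nlinarith
  · rintro _ ⟨u, c, m, rfl, hm3⟩
    obtain rfl : m = conflictTable s.m0 s.n s.k s.r := by
      rw [hm3]
      funext a
      simp only [conflictTable]
      split_ifs <;> simp_all
    exact ⟨_, _, _, rfl⟩

/-! ### Choosing the next coordinate, and the layout loop -/

/-- Finds the cheapest next coordinate: bank `5` tells which coordinates are available, and the
cost of `i` is the conflict of `i` with register `3` plus an entry of bank `6`. -/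
def selectCmd : Cmd :=
  .seq (.assign 6 (.reg 1 + .lit 2)) (forLoop 11 (.reg 1) (.cond (.load 5 (.reg 11))
    (.seq (.assign 12 (.load 3 (.reg 3 * .reg 1 + .reg 11) +
      .load 6 ((.reg 5 - .load 7 (.reg 11)) * (.reg 1 + .lit 1) + .reg 11)))
      (.cond (.bin .lt (.reg 12) (.reg 6))
        (.seq (.assign 6 (.reg 12)) (.assign 7 (.reg 11))) .nop)) .nop))

/-- Register `5` holds the code of the available set and bank `7` the weight of each coordinate, so
`S - m7 i` is the code after removing `i`, and bank `6` supplies the cost of continuing from there.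
The initial best cost `k + 2` acts as infinity, since all costs are at most `k + 1`. -/
theorem runs_selectCmd {B : ℕ} {s : Config} {A : Finset ℕ} {w : ℕ → ℕ}
    (hk : s.k + 3 < B) (hA : ∀ i < s.k, s.m5 i = if i ∈ A then 1 else 0)
    (hAk : A ⊆ Finset.range s.k) (hcur : s.cur * s.k + s.k < B) (hS : s.S < B)
    (h7 : ∀ i ∈ A, s.m7 i < B)
    (hadr : ∀ i ∈ A, (s.S - s.m7 i) * (s.k + 1) + i < B)
    (hw : ∀ i ∈ A, s.m3 (s.cur * s.k + i) + s.m6 ((s.S - s.m7 i) * (s.k + 1) + i) = w i)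
    (hwk : ∀ i ∈ A, w i ≤ s.k + 1) :
    Runs B selectCmd s (50 * (s.k + 1)) fun s' => ∃ bc bi i c,
      s' = { s with bc := bc, bi := bi, i := i, c := c } ∧
      (A.Nonempty → bi ∈ A ∧ bc = w bi ∧ ∀ j ∈ A, w bi ≤ w j) := by
  refine Runs.assign_seq (T₂ := 45 * (s.k + 1)) (by norm_num) (by simp; omega)
    ((Runs.forLoop (by norm_num) (N := s.k) (T₁ := 35)
    (Inv := fun j s' => ∃ bc bi c, s' = { s with bc := bc, bi := bi, i := j, c := c } ∧
      (bc = s.k + 2 ∨ bi ∈ A ∧ bc = w bi) ∧ bc ≤ s.k + 2 ∧ ∀ l ∈ A, l < j → bc ≤ w l)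
    (by omega) ?_ ?_ ?_ ?_).mono le_rfl ?_) (by simp; omega)
  · rintro j hj _ ⟨bc, bi, c, rfl, -⟩
    simp
    omega
  · rintro j hj _ ⟨bc, bi, c, rfl, h1, h2, h3⟩
    refine Runs.cond (T₁ := 32) ?_ (fun hv => ?_) (fun hv => ?_) (by simp)
    · simp [hA j hj]
      have := ite_one_zero_le (j ∈ A)
      omega
    · have hjA : j ∈ A := by
        simp [hA j hj] at hv
        exact hv
      have e1 := hadr j hjA
      have e2 := hw j hjA
      have e3 := hwk j hjA
      have e4 := h7 j hjA
      have e6 : s.cur ≤ s.cur * s.k := Nat.le_mul_of_pos_right _ (by omega)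
      have e5 : s.S - s.m7 j ≤ (s.S - s.m7 j) * (s.k + 1) := Nat.le_mul_of_pos_right _ (by omega)
      refine Runs.assign_seq (T₂ := 12) (by norm_num) ?_ ?_ (by simp)
      · simp
        omega
      · refine Runs.cond (T₁ := 4) ?_ (fun hv => ?_) (fun hv => ?_) (by simp)
        · simp
          have := ite_one_zero_le (s.m3 (s.cur * s.k + j) +
            s.m6 ((s.S - s.m7 j) * (s.k + 1) + j) < bc)
          omega
        · simp [e2] at hv
          refine Runs.assign_seq (T₂ := 2) (by norm_num) (by simp; omega)
            (Runs.assign (by norm_num) (by simp; omega) (by simp) ?_) (by simp)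
          refine ⟨by simp, _, _, _, rfl, Or.inr ⟨hjA, by simpa using e2⟩,
            ?_, ?_⟩
          · simp; omega
          · intro l hl hlj
            simp [e2]
            rcases Nat.lt_succ_iff_lt_or_eq.1 hlj with hlj | rfl
            · exact hv.le.trans (h3 l hl hlj)
            · exact le_rfl
        · simp [e2] at hv
          refine Runs.nop ⟨by simp, _, _, _, rfl, h1, h2, ?_⟩ (by norm_num)
          intro l hl hlj
          rcases Nat.lt_succ_iff_lt_or_eq.1 hlj with hlj | rfl
          · exact h3 l hl hlj
          · exact hv
    · have hjA : j ∉ A := by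
        simp [hA j hj] at hv
        exact hv
      refine Runs.nop ⟨by simp, _, _, _, rfl, h1, h2, ?_⟩ (by norm_num)
      intro l hl hlj
      exact h3 l hl (by rcases Nat.lt_succ_iff_lt_or_eq.1 hlj with hlj | rfl
                        · exact hlj
                        · exact absurd hl hjA)
  · exact ⟨_, _, _, rfl, by simp⟩
  · simp
    omega
  · rintro _ ⟨bc, bi, c, rfl, h1, h2, h3⟩
    refine ⟨_, _, _, _, rfl, ?_⟩
    rintro ⟨l, hl⟩
    have hb : bi ∈ A ∧ bc = w bi := by
      rcases h1 with h1 | h1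
      · have := h3 l hl (Finset.mem_range.1 (hAk hl))
        have := hwk l hl
        omega
      · exact h1
    exact ⟨hb.1, hb.2, fun j hj => hb.2 ▸ h3 j hj (Finset.mem_range.1 (hAk hj))⟩

/-- Fills bank `5` with the values of `e`, which may depend on register `11`. -/
def fillCmd (e : Expr) : Cmd := forLoop 11 (.reg 1) (.store 5 (.reg 11) e)

theorem runs_fillCmd {B : ℕ} {s : Config} {e : Expr} {v : ℕ → ℕ} (hk : s.k + 1 < B)
    (he : ∀ i < s.k, ∀ m, e.Fits B { s with i := i, m5 := m }.st ∧
      e.eval { s with i := i, m5 := m }.st = v i) :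
    Runs B (fillCmd e) s ((s.k + 1) * (e.cost + 10)) fun s' => ∃ i m,
      s' = { s with i := i, m5 := m } ∧ ∀ i < s.k, m i = v i := by
  refine (Runs.forLoop (by norm_num) (N := s.k) (T₁ := e.cost + 2)
    (Inv := fun j s' => ∃ m, s' = { s with i := j, m5 := m } ∧ ∀ i < j, m i = v i)
    hk ?_ ?_ ?_ ?_).mono le_rfl ?_
  · rintro j hj _ ⟨m, rfl, -⟩
    simp
    omega
  · rintro j hj _ ⟨m, rfl, hm⟩
    obtain ⟨h1, h2⟩ := he j hj m
    refine Runs.store (by norm_num) (by simp; omega) h1 (by simp; omega)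
      ⟨rfl, _, rfl, fun i hi => ?_⟩
    rw [h2]
    simp
    by_cases hij : i = j
    · subst hij; simp
    · rw [Function.update_of_ne hij]
      exact hm i (by omega)
  · exact ⟨_, rfl, by simp⟩
  · exact le_of_eq (by rw [Expr.cost_reg]; ring)
  · rintro _ ⟨m, rfl, hm⟩
    exact ⟨_, _, rfl, hm⟩

/-- Lays out the coordinates one after the other, always taking the cheapest next one. -/
def layoutCmd : Cmd :=
  .seq (.assign 3 (.reg 1)) (.seq (.assign 4 (.lit 0)) (forLoop 13 (.reg 1)
    (.seq selectCmd
    (.seq (.store 5 (.reg 7) (.lit 0))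
    (.seq (.assign 5 (.reg 5 - .load 7 (.reg 7)))
    (.seq (.store 4 (.reg 7) (.reg 4 + .load 3 (.reg 3 * .reg 1 + .reg 7)))
    (.seq (.assign 4 (.load 4 (.reg 7) + .lit 1))
    (.assign 3 (.reg 7)))))))))

/-- The look-ahead cost `d` and the invariant `J` are left abstract so that one program serves
twice: `d = 0` with zero weights is the greedy layout, `d = minBreaks` with weights `2 ^ i` the
optimal one. -/
theorem runs_layoutCmd {B : ℕ} {s : Config} {d : Finset ℕ → ℕ → ℕ}
    {J : Finset ℕ → ℕ → ℕ → (ℕ → ℕ) → Prop}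
    (hB : (s.k + 1) * (s.k + 1) + 2 * s.k + 3 < B) (h5 : ∀ i < s.k, s.m5 i = 1)
    (hS : s.S = ∑ i ∈ Finset.range s.k, s.m7 i) (h3 : ∀ j, s.m3 j ≤ 1)
    (hadr : ∀ i < s.k, s.S * (s.k + 1) + i < B)
    (h6 : ∀ A ⊆ Finset.range s.k, ∀ i < s.k, i ∉ A →
      s.m6 ((∑ j ∈ A, s.m7 j) * (s.k + 1) + i) = d A i ∧ d A i ≤ s.k)
    (hJ0 : J (Finset.range s.k) s.k 0 s.m4)
    (hJ : ∀ A c q p, J A c q p → ∀ i ∈ A, (∀ j ∈ A, s.m3 (c * s.k + i) + d (A.erase i) i ≤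
        s.m3 (c * s.k + j) + d (A.erase j) j) →
      J (A.erase i) i (q + s.m3 (c * s.k + i) + 1)
        (Function.update p i (q + s.m3 (c * s.k + i)))) :
    Runs B layoutCmd s (200 * ((s.k + 1) * (s.k + 1))) fun s' =>
      ∃ cur q S bc bi i c t m4 m5, s' = { s with
        cur := cur, q := q, S := S, bc := bc, bi := bi, i := i, c := c, t := t, m4 := m4, m5 := m5 } ∧
        J ∅ cur q m4 ∧ q ≤ 2 * s.k := by
  have hkB : s.k * s.k + 2 * s.k + 1 + 2 * s.k + 3 < B := by nlinarith
  refine Runs.assign_seq (T₂ := 190 * ((s.k + 1) * (s.k + 1)) + 2) (by norm_num)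
    (by simp; omega) (Runs.assign_seq (T₂ := 190 * ((s.k + 1) * (s.k + 1))) (by norm_num)
      (by simp; omega) ((Runs.forLoop (by norm_num) (N := s.k) (T₁ := 50 * (s.k + 1) + 40)
    (Inv := fun j s' => ∃ cur q S bc bi i c m4 m5, s' = { s with
        cur := cur, q := q, S := S, bc := bc, bi := bi, i := i, c := c, t := j, m4 := m4, m5 := m5 } ∧
      ∃ A ⊆ Finset.range s.k, A.card + j = s.k ∧ (∀ i < s.k, m5 i = if i ∈ A then 1 else 0) ∧
        S = ∑ i ∈ A, s.m7 i ∧ J A cur q m4 ∧ q ≤ 2 * j ∧ cur ≤ s.k)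
    (by omega) ?_ ?_ ?_ ?_).mono le_rfl ?_) (by simp; omega)) (by simp; nlinarith)
  · rintro j hj _ ⟨cur, q, S, bc, bi, i, c, m4, m5, rfl, -⟩
    simp
    omega
  · rintro j hj _ ⟨cur, q, S, bc, bi, i, c, m4, m5, rfl, A, hAk, hAj, hm5, hSA, hJA, hq, hcur⟩
    have hne : A.Nonempty := Finset.card_pos.1 (by omega)
    have hcurk : cur * s.k ≤ s.k * s.k := Nat.mul_le_mul_right _ hcur
    have hSS : S ≤ s.S := by
      rw [hSA, hS]
      exact Finset.sum_le_sum_of_subset hAk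
    have hSB : s.S < B := by
      have h0 := hadr 0 (by omega)
      have : s.S ≤ s.S * (s.k + 1) := Nat.le_mul_of_pos_right _ (by omega)
      omega
    have h7S : ∀ i ∈ A, s.m7 i ≤ S := fun i hi => by
      rw [hSA]
      exact Finset.single_le_sum (f := s.m7) (fun _ _ => Nat.zero_le _) hi
    have herase : ∀ i ∈ A, S - s.m7 i = ∑ j ∈ A.erase i, s.m7 j := fun i hi => by
      have := Finset.sum_erase_add A s.m7 hi
      omega
    have h6A : ∀ i ∈ A, _ := fun i hi => h6 (A.erase i) ((Finset.erase_subset _ _).trans hAk) i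
      (Finset.mem_range.1 (hAk hi)) (by simp)
    refine Runs.seq (T₂ := 40) (runs_selectCmd (A := A)
      (w := fun i => s.m3 (cur * s.k + i) + d (A.erase i) i) (by simp; omega) hm5 hAk
      (by simp; omega) (by simp; omega) ?_ ?_ ?_ ?_) ?_ (by simp)
    · intro i hi
      have := h7S i hi
      simp
      omega
    · intro i hi
      have h1 := hadr i (Finset.mem_range.1 (hAk hi))
      have h2 : (S - s.m7 i) * (s.k + 1) ≤ s.S * (s.k + 1) := Nat.mul_le_mul_right _ (by omega)
      simp
      omega
    · intro i hi
      simp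
      rw [herase i hi, (h6A i hi).1]
    · intro i hi
      have h1 := (h6A i hi).2
      have h2 := h3 (cur * s.k + i)
      simp
      omega
    · rintro _ ⟨bc, bi, i, c, rfl, hsel⟩
      obtain ⟨hbi, -, hmin⟩ := hsel hne
      have hbk := Finset.mem_range.1 (hAk hbi)
      have h1 := h7S bi hbi
      have h2 := h3 (cur * s.k + bi)
      refine Runs.store_seq (T₂ := 36) (by norm_num) (by simp; omega) (by simp; omega) ?_ (by simp)
      refine Runs.assign_seq (T₂ := 26) (by norm_num) (by simp; omega) ?_ (by simp)
      refine Runs.store_seq (T₂ := 15) (by norm_num) (by simp; omega) (by simp; omega) ?_ (by simp)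
      refine Runs.assign_seq (T₂ := 2) (by norm_num) (by simp; omega) ?_ (by simp)
      refine Runs.assign (by norm_num) (by simp; omega) (by simp) ?_
      refine ⟨rfl, _, _, _, _, _, _, _, _, _, rfl, A.erase bi, ?_, ?_, ?_, ?_, ?_, ?_, ?_⟩
      · exact (Finset.erase_subset _ _).trans hAk
      · have := Finset.card_erase_add_one hbi
        omega
      · intro i hi
        simp
        by_cases hib : i = bi
        · subst hib; simp
        · simp [hib, hm5 i hi]
      · simp
        exact herase bi hbi
      · have := hJ A cur q m4 hJA bi hbi hmin
        simpa using this
      · simp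
        omega
      · simp
        omega
  · refine ⟨_, _, _, _, _, _, _, _, _, rfl, Finset.range s.k, subset_rfl, by simp, ?_, ?_, ?_, ?_, ?_⟩
    · intro i hi
      simp [hi, h5 i hi]
    · simpa using hS
    · simpa using hJ0
    · simp
    · simp
  · simp
    nlinarith
  · rintro _ ⟨cur, q, S, bc, bi, i, c, m4, m5, rfl, A, hAk, hAj, hm5, hSA, hJA, hq, hcur⟩
    obtain rfl : A = ∅ := Finset.card_eq_zero.1 (by omega)
    exact ⟨_, _, _, _, _, _, _, _, _, _, rfl, hJA, hq⟩

/-! ## Dynamic programming over sets of coordinates -/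

theorem sum_bits (S k : ℕ) : ∑ i ∈ Finset.range k, S / 2 ^ i % 2 * 2 ^ i = S % 2 ^ k := by
  induction k with
  | zero => simp [Nat.mod_one]
  | succ k ih => rw [Finset.sum_range_succ, ih, Nat.mod_pow_succ, mul_comm]

/-- Sets of coordinates are coded by numbers below `2 ^ k`, and the machine recovers membership by
division. -/
theorem exists_mask {S k : ℕ} (h : S < 2 ^ k) : ∃ A ⊆ Finset.range k,
    ∑ i ∈ A, 2 ^ i = S ∧ ∀ i < k, S / 2 ^ i % 2 = if i ∈ A then 1 else 0 := by
  refine ⟨(Finset.range k).filter (fun i => S / 2 ^ i % 2 = 1), Finset.filter_subset _ _, ?_, ?_⟩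
  · rw [Finset.sum_filter]
    refine Eq.trans ?_ ((sum_bits S k).trans (Nat.mod_eq_of_lt h))
    refine Finset.sum_congr rfl fun i _ => ?_
    rcases Nat.mod_two_eq_zero_or_one (S / 2 ^ i) with h | h <;> simp [h]
  · intro i hi
    rcases Nat.mod_two_eq_zero_or_one (S / 2 ^ i) with h | h <;> simp [h, hi]

theorem sum_two_pow_inj {A A' : Finset ℕ} (h : ∑ i ∈ A, 2 ^ i = ∑ i ∈ A', 2 ^ i) : A = A' :=
  Finset.geomSum_injective le_rfl h

theorem sum_two_pow_lt {A : Finset ℕ} {k : ℕ} (h : A ⊆ Finset.range k) :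
    ∑ i ∈ A, 2 ^ i < 2 ^ k := by
  have h1 := Finset.sum_le_sum_of_subset (f := fun i => 2 ^ i) h
  have h2 := Nat.geomSum_lt (m := 2) (n := k) (s := Finset.range k) le_rfl
    (fun i hi => Finset.mem_range.1 hi)
  omega

/-- Stores the powers of two in bank `7`, and `2 ^ k` in register `8`. -/
def powersCmd : Cmd :=
  .seq (.assign 8 (.lit 1)) (forLoop 11 (.reg 1)
    (.seq (.store 7 (.reg 11) (.reg 8)) (.assign 8 (.reg 8 + .reg 8))))

theorem runs_powersCmd {B : ℕ} {s : Config} (hB : 2 ^ s.k + s.k + 1 < B) :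
    Runs B powersCmd s (20 * (s.k + 1)) fun s' => ∃ i m,
      s' = { s with x := 2 ^ s.k, i := i, m7 := m } ∧ ∀ i < s.k, m i = 2 ^ i := by
  have h1 : 1 ≤ 2 ^ s.k := Nat.one_le_two_pow
  refine Runs.assign_seq (T₂ := 15 * (s.k + 1)) (by norm_num) (by simp; omega)
    ((Runs.forLoop (by norm_num) (N := s.k) (T₁ := 7)
    (Inv := fun j s' => ∃ x m, s' = { s with x := x, i := j, m7 := m } ∧ x = 2 ^ j ∧
      ∀ i < j, m i = 2 ^ i)
    (by omega) ?_ ?_ ?_ ?_).mono le_rfl ?_) (by simp; omega)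
  · rintro j hj _ ⟨x, m, rfl, -⟩
    simp
    omega
  · rintro j hj _ ⟨x, m, rfl, rfl, hm⟩
    have h2 : 2 ^ (j + 1) ≤ 2 ^ s.k := Nat.pow_le_pow_right (by norm_num) hj
    rw [pow_succ] at h2
    refine Runs.store_seq (T₂ := 4) (by norm_num) (by simp; omega) (by simp; omega)
      (Runs.assign (by norm_num) (by simp; omega) (by simp) ?_) (by simp)
    refine ⟨rfl, _, _, rfl, ?_, ?_⟩
    · simp [pow_succ, mul_two]
    · intro i hi
      simp
      by_cases hij : i = j
      · subst hij; simp
      · rw [Function.update_of_ne hij]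
        exact hm i (by omega)
  · exact ⟨_, _, rfl, by simp, by simp⟩
  · simp
    omega
  · rintro _ ⟨x, m, rfl, rfl, hm⟩
    exact ⟨_, _, rfl, hm⟩

/-- Fills one row of the table of `minBreaks`, that for the set encoded by register `5`. -/
def rowCmd : Cmd :=
  forLoop 3 (.reg 1 + .lit 1)
    (.seq selectCmd (.store 6 (.reg 5 * (.reg 1 + .lit 1) + .reg 3) (.reg 6)))

/-- The table `m` contains the values of `minBreaks` for the set `A`. -/
def IsRow (N : ℕ → ℕ → ℕ) (k : ℕ) (m : ℕ → ℕ) (A : Finset ℕ) : Prop :=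
  ∀ c ≤ k, m ((∑ i ∈ A, 2 ^ i) * (k + 1) + c) = minBreaks N A c

/-- Removing an element lowers the code of a set, so all rows consulted for `A` are already filled.
The current coordinate is the loop counter and takes the value `k` too, which gives the entry for
the virtual start. -/
theorem runs_rowCmd {B : ℕ} {s : Config} {A : Finset ℕ} {N : ℕ → ℕ → ℕ}
    (hN : ∀ i j, N i j = s.m3 (i * s.k + j)) (h3 : ∀ j, s.m3 j ≤ 1)
    (hB : 2 ^ s.k * (s.k + 1) + (s.k + 1) * (s.k + 1) + s.k + 3 < B)
    (hAk : A ⊆ Finset.range s.k) (hne : A.Nonempty)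
    (hA : ∀ i < s.k, s.m5 i = if i ∈ A then 1 else 0)
    (hS : s.S = ∑ i ∈ A, 2 ^ i) (h7 : ∀ i < s.k, s.m7 i = 2 ^ i)
    (hrow : ∀ A' ⊆ Finset.range s.k, ∑ i ∈ A', 2 ^ i < s.S → IsRow N s.k s.m6 A') :
    Runs B rowCmd s (80 * ((s.k + 2) * (s.k + 2))) fun s' => ∃ cur bc bi i c m6,
      s' = { s with cur := cur, bc := bc, bi := bi, i := i, c := c, m6 := m6 } ∧
      ∀ A' ⊆ Finset.range s.k, ∑ i ∈ A', 2 ^ i < s.S + 1 → IsRow N s.k m6 A' := by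
  have hN1 : ∀ i j, N i j ≤ 1 := fun i j => by rw [hN]; exact h3 _
  have hSk : s.S < 2 ^ s.k := hS ▸ sum_two_pow_lt hAk
  have hSB : s.S * (s.k + 1) + s.k + 1 ≤ 2 ^ s.k * (s.k + 1) := by nlinarith
  have hkB : 2 ^ s.k * (s.k + 1) + (s.k * s.k + 2 * s.k + 1) + s.k + 3 < B := by nlinarith
  have hS1 : s.S ≤ s.S * (s.k + 1) := Nat.le_mul_of_pos_right _ (by omega)
  have hlt : ∀ i ∈ A, ∑ j ∈ A.erase i, 2 ^ j + 2 ^ i = s.S := fun i hi => by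
    rw [hS, Finset.sum_erase_add A _ hi]
  refine (Runs.forLoop (by norm_num) (N := s.k + 1) (T₁ := 50 * (s.k + 1) + 10)
    (Inv := fun j s' => ∃ bc bi i c m6,
      s' = { s with cur := j, bc := bc, bi := bi, i := i, c := c, m6 := m6 } ∧
      (∀ A' ⊆ Finset.range s.k, ∑ i ∈ A', 2 ^ i < s.S → IsRow N s.k m6 A') ∧
      ∀ c < j, m6 (s.S * (s.k + 1) + c) = minBreaks N A c)
    (by omega) ?_ ?_ ?_ ?_).mono le_rfl ?_
  · rintro j hj _ ⟨bc, bi, i, c, m6, rfl, -⟩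
    simp
    omega
  · rintro j hj _ ⟨bc, bi, i, c, m6, rfl, hm, hm'⟩
    have hj1 : j * s.k ≤ s.k * s.k := Nat.mul_le_mul_right _ (by omega)
    have hval : ∀ i ∈ A, m6 ((s.S - s.m7 i) * (s.k + 1) + i) = minBreaks N (A.erase i) i := by
      intro i hi
      have hik := Finset.mem_range.1 (hAk hi)
      have h1 := hlt i hi
      have h2 : 0 < 2 ^ i := by positivity
      rw [h7 i hik, show s.S - 2 ^ i = ∑ j ∈ A.erase i, 2 ^ j by omega]
      exact hm _ ((Finset.erase_subset _ _).trans hAk) (by omega) i hik.le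
    refine Runs.seq (T₂ := 10) (runs_selectCmd (A := A)
      (w := fun i => N j i + minBreaks N (A.erase i) i) (by simp; omega) hA hAk
      (by simp; omega) (by simp; omega) ?_ ?_ ?_ ?_) ?_ (by simp)
    · intro i hi
      have := hlt i hi
      simp
      rw [h7 i (Finset.mem_range.1 (hAk hi))]
      omega
    · intro i hi
      have := Finset.mem_range.1 (hAk hi)
      have h2 : (s.S - s.m7 i) * (s.k + 1) ≤ s.S * (s.k + 1) := Nat.mul_le_mul_right _ (by omega)
      simp
      omega
    · intro i hi
      simp
      rw [hval i hi, hN]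
    · intro i hi
      have h1 := minBreaks_le_card hN1 (A.erase i) i
      have h2 := Finset.card_erase_add_one hi
      have h3 := Finset.card_le_card hAk
      have h4 := hN1 j i
      rw [Finset.card_range] at h3
      simp
      omega
    · rintro _ ⟨bc, bi, i, c, rfl, hsel⟩
      obtain ⟨hbi, hbc, hmin⟩ := hsel hne
      rw [← minBreaks_eq_of_forall_le N hbi hmin] at hbc
      have h1 := minBreaks_le_card hN1 A j
      have h3 := Finset.card_le_card hAk
      rw [Finset.card_range] at h3
      refine Runs.store (by norm_num) (by simp; omega) (by simp; omega) (by simp) ?_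
      refine ⟨rfl, _, _, _, _, _, rfl, ?_, ?_⟩
      · intro A' hA' hlt' c hc
        simp
        rw [Function.update_of_ne]
        · exact hm A' hA' hlt' c hc
        -- Rows have width `k + 1`, so a row of smaller code ends before the row being written
        -- begins.
        · have : (∑ i ∈ A', 2 ^ i + 1) * (s.k + 1) ≤ s.S * (s.k + 1) :=
            Nat.mul_le_mul_right _ hlt'
          rw [Nat.add_mul] at this
          omega
      · intro c hc
        simp
        by_cases hcj : c = j
        · subst hcj
          rw [Function.update_self, hbc]
        · rw [Function.update_of_ne (by omega)]
          exact hm' c (by omega)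
  · exact ⟨_, _, _, _, _, rfl, hrow, by simp⟩
  · simp
    nlinarith
  · rintro _ ⟨bc, bi, i, c, m6, rfl, hm, hm'⟩
    refine ⟨_, _, _, _, _, _, rfl, ?_⟩
    intro A' hA' hlt'
    rcases Nat.lt_succ_iff_lt_or_eq.1 hlt' with hlt' | heq
    · exact hm A' hA' hlt'
    · intro c hc
      rw [heq, hm' c (by omega), sum_two_pow_inj (heq.trans hS)]

/-- Fills the table of `minBreaks`. -/
def tableCmd : Cmd :=
  .seq (.assign 5 (.lit 1)) (.loop (.bin .lt (.reg 5) (.reg 8))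
    (.seq (fillCmd (.reg 5 / .load 7 (.reg 11) % .lit 2))
    (.seq rowCmd (.assign 5 (.reg 5 + .lit 1)))))

/-- Codes are treated in increasing order from `1` on; the row of the empty set consists of the
initial zeros of bank `6`, which are its correct values. -/
theorem runs_tableCmd {B : ℕ} {s : Config} {N : ℕ → ℕ → ℕ}
    (hN : ∀ i j, N i j = s.m3 (i * s.k + j)) (h3 : ∀ j, s.m3 j ≤ 1)
    (hB : 2 ^ s.k * (s.k + 1) + (s.k + 1) * (s.k + 1) + s.k + 3 < B)
    (hx : s.x = 2 ^ s.k) (h7 : ∀ i < s.k, s.m7 i = 2 ^ i) (h6 : s.m6 = fun _ => 0) :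
    Runs B tableCmd s (150 * (2 ^ s.k * ((s.k + 2) * (s.k + 2)))) fun s' =>
      ∃ cur S bc bi i c m5 m6, s' = { s with
        cur := cur, S := S, bc := bc, bi := bi, i := i, c := c, m5 := m5, m6 := m6 } ∧
      ∀ A ⊆ Finset.range s.k, IsRow N s.k m6 A := by
  have h1 : 1 ≤ 2 ^ s.k := Nat.one_le_two_pow
  have hx1 : 2 ^ s.k ≤ 2 ^ s.k * (s.k + 1) := Nat.le_mul_of_pos_right _ (by omega)
  refine Runs.assign_seq (T₂ := 2 ^ s.k * (140 * ((s.k + 2) * (s.k + 2)))) (by norm_num)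
    (by simp; omega) ((Runs.loop (N := 2 ^ s.k - 1) (T₁ := 130 * ((s.k + 2) * (s.k + 2)))
    (Inv := fun j s' => ∃ cur bc bi i c m5 m6, s' = { s with
        cur := cur, S := j + 1, bc := bc, bi := bi, i := i, c := c, m5 := m5, m6 := m6 } ∧
      ∀ A ⊆ Finset.range s.k, ∑ i ∈ A, 2 ^ i < j + 1 → IsRow N s.k m6 A)
    ?_ ?_ ?_ ?_).mono le_rfl ?_) ?_
  · rintro j hj _ ⟨cur, bc, bi, i, c, m5, m6, rfl, hm⟩
    refine ⟨by simp; split <;> omega, by simp; omega, ?_⟩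
    obtain ⟨A, hAk, hAS, hA⟩ := exists_mask (S := j + 1) (k := s.k) (by omega)
    have hne : A.Nonempty := by
      rw [Finset.nonempty_iff_ne_empty]
      rintro rfl
      simp at hAS
    refine Runs.seq (T₂ := 80 * ((s.k + 2) * (s.k + 2)) + 4)
      (runs_fillCmd (v := fun i => if i ∈ A then 1 else 0) (by simp; omega) ?_) ?_ ?_
    · intro i hi m
      have hi : i < s.k := hi
      have h2 : 2 ^ i < 2 ^ s.k := Nat.pow_lt_pow_right (by norm_num) hi
      simp [h7 i hi, hA i hi]
      omega
    · rintro _ ⟨i, m, rfl, hm5⟩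
      refine Runs.seq (T₂ := 4) (runs_rowCmd (A := A) (N := N) hN h3 hB hAk hne hm5 hAS.symm h7 hm)
        ?_ le_rfl
      rintro _ ⟨cur, bc, bi, i, c, m6, rfl, hm'⟩
      refine Runs.assign (by norm_num) (by simp; omega) (by simp) ?_
      exact ⟨_, _, _, _, _, _, _, rfl, hm'⟩
    · simp
      nlinarith
  · rintro _ ⟨cur, bc, bi, i, c, m5, m6, rfl, hm⟩
    have h2 : 2 ^ s.k - 1 + 1 = 2 ^ s.k := by omega
    simp [hx, h2]
    omega
  · refine ⟨_, _, _, _, _, _, _, rfl, ?_⟩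
    intro A hA hlt c hc
    have : A = ∅ := sum_two_pow_inj (by rw [Finset.sum_empty]; omega)
    subst this
    simp [h6]
  · simp
    obtain ⟨P, hP⟩ : ∃ P, 2 ^ s.k = P + 1 := ⟨2 ^ s.k - 1, by omega⟩
    rw [hP, Nat.add_sub_cancel]
    nlinarith
  · rintro _ ⟨cur, bc, bi, i, c, m5, m6, rfl, hm⟩
    refine ⟨_, _, _, _, _, _, _, _, rfl, ?_⟩
    intro A hA
    exact hm A hA (by have := sum_two_pow_lt hA; omega)
  · have : 1 ≤ 2 ^ s.k * ((s.k + 2) * (s.k + 2)) := Nat.one_le_iff_ne_zero.2 (by positivity)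
    simp
    nlinarith

/-! ### Writing the output -/

/-- Writes the output table for the layout with positions in bank `4`, all below register `4`. -/
def outputCmd : Cmd :=
  .seq (.assign 4 (.reg 4 + .bin .eq (.reg 4) (.lit 0)))
  (.seq (forLoop 9 (.reg 0 * .reg 1) (.store 2 (.reg 9 / .reg 1 * .reg 4 + .load 4 (.reg 9 % .reg 1))
    (bitDiffExpr (.reg 9 / .reg 1) (.reg 9 % .reg 1))))
  (.assign 0 (.reg 4)))

theorem mul_add_inj {u v f a b : ℕ} (ha : a < f) (hb : b < f) (h : u * f + a = v * f + b) :
    u = v ∧ a = b := by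
  have hf : 0 < f := by omega
  have h1 := congrArg (· / f) h
  have h2 := congrArg (· % f) h
  simp only [mul_comm _ f, Nat.mul_add_div hf, Nat.mul_add_mod, Nat.div_eq_of_lt ha,
    Nat.div_eq_of_lt hb, Nat.mod_eq_of_lt ha, Nat.mod_eq_of_lt hb] at h1 h2
  exact ⟨by omega, h2⟩

/-- The table `m` has value `v u i` in row `u` and column `p i`, and zeros in the columns that
are not of the form `p i`. -/
def IsSpread (n k f : ℕ) (v : ℕ → ℕ → ℕ) (p m : ℕ → ℕ) : Prop :=
  ∀ u < n, (∀ i < k, m (u * f + p i) = v u i) ∧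
    ∀ j < f, (∀ i < k, p i ≠ j) → m (u * f + j) = 0

/-- The width is `max q 1` because an empty layout has `q = 0`, whereas Fibonacci cubes have
dimension at least `1`. Columns not used by the layout keep their initial zeros, and injectivity of
the positions keeps written entries from being overwritten. -/
theorem runs_outputCmd {B : ℕ} {s : Config} (hm : ∀ j, s.m0 j ≤ 1) (hr : s.r < s.n)
    (hB : s.n * s.k + s.n * (s.q + 1) + s.n + s.k + 3 < B) (hp : ∀ i < s.k, s.m4 i < s.q)
    (hinj : ∀ i < s.k, ∀ j < s.k, s.m4 i = s.m4 j → i = j) (h2 : s.m2 = fun _ => 0) :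
    Runs B outputCmd s (100 * (s.n * s.k + 1)) fun s' => s'.n = max s.q 1 ∧
      IsSpread s.n s.k (max s.q 1) (bitDiff s.m0 s.k s.r) s.m4 s'.m2 := by
  have hf : s.q + (if s.q = 0 then 1 else 0) = max s.q 1 := by split <;> omega
  have hn : 0 < s.n := by omega
  have hnf : s.n * max s.q 1 ≤ s.n * (s.q + 1) := Nat.mul_le_mul_left _ (by omega)
  have hq : s.q + 1 ≤ s.n * (s.q + 1) := Nat.le_mul_of_pos_left _ hn
  generalize hfdef : max s.q 1 = f at *
  have hpf : ∀ i < s.k, s.m4 i < f := fun i hi => by have := hp i hi; omega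
  have hT : 100 * (s.n * s.k + 1) = 6 + ((s.n * s.k + 1) * (3 + 7 + 52) + 2) +
    (38 * (s.n * s.k) + 30) := by ring
  refine Runs.assign_seq (T₂ := (s.n * s.k + 1) * (3 + 7 + 52) + 2) (by norm_num)
    (by simp; split <;> omega) ?_ (by simp; omega)
  refine Runs.seq (T₂ := 2) (Runs.forLoop (by norm_num) (N := s.n * s.k) (T₁ := 52)
    (Inv := fun j s' => ∃ m2, s' = { s with q := f, a := j, m2 := m2 } ∧
      (∀ u i, i < s.k → u * s.k + i < j → m2 (u * f + s.m4 i) = bitDiff s.m0 s.k s.r u i) ∧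
      ∀ u < s.n, ∀ j < f, (∀ i < s.k, s.m4 i ≠ j) → m2 (u * f + j) = 0)
    (by omega) ?_ ?_ ?_ (le_of_eq rfl)) ?_ le_rfl
  · rintro j hj _ ⟨m2, rfl, -⟩
    simp
    omega
  · rintro j hj _ ⟨m2, rfl, hA, hC⟩
    have hk : 0 < s.k := Nat.pos_of_ne_zero (by rintro h; simp [h] at hj)
    have hdiv : j / s.k < s.n := Nat.div_lt_of_lt_mul (by rwa [mul_comm])
    have hmod : j % s.k < s.k := Nat.mod_lt _ hk
    have h3 := hpf _ hmod
    have h4 := mul_add_lt hdiv h3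
    refine Runs.store (by norm_num) ?_ ?_ (by simp) ⟨rfl, _, rfl, ?_, ?_⟩
    · simp
      omega
    · exact fits_bitDiffExpr (by simp; omega) hm hr (by simp; omega) hdiv (by simp; omega) hmod
    · intro u i hi hlt
      simp
      by_cases hui : u * s.k + i = j
      · have h5 : j / s.k = u := by
          rw [← hui, mul_comm, Nat.mul_add_div hk, Nat.div_eq_of_lt hi, add_zero]
        have h6 : j % s.k = i := by
          rw [← hui, mul_comm, Nat.mul_add_mod, Nat.mod_eq_of_lt hi]
        rw [h5, h6, Function.update_self]
      · rw [Function.update_of_ne]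
        · exact hA u i hi (by omega)
        · intro heq
          obtain ⟨h5, h6⟩ := mul_add_inj (hpf i hi) h3 heq
          have h7 := hinj i hi _ hmod h6
          apply hui
          rw [h5, h7, mul_comm]
          exact Nat.div_add_mod j s.k
    · intro u hu l hl hne
      simp
      rw [Function.update_of_ne]
      · exact hC u hu l hl hne
      · intro heq
        exact hne _ hmod (mul_add_inj hl h3 heq).2.symm
  · exact ⟨s.m2, by simp [hf], by simp, fun _ _ _ _ _ => congrFun h2 _⟩
  · rintro _ ⟨m2, rfl, hA, hC⟩
    refine Runs.assign (by norm_num) (by simp; omega) (by simp) ⟨rfl, fun u hu => ⟨?_, hC u hu⟩⟩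
    intro i hi
    exact hA u i hi (mul_add_lt hu hi)

/-! ### The optimal layout and the main program -/

/-- Replaces the greedy layout by an optimal one. -/
def optimalCmd : Cmd :=
  .seq powersCmd (.seq tableCmd (.seq (fillCmd (.lit 1)) (.seq (.assign 5 (.reg 8 - .lit 1))
    layoutCmd)))

theorem runs_optimalCmd {B : ℕ} {s : Config} {N : ℕ → ℕ → ℕ}
    (hN : ∀ i j, N i j = s.m3 (i * s.k + j)) (h3 : ∀ j, s.m3 j ≤ 1)
    (hB : 2 ^ s.k * (s.k + 1) + (s.k + 1) * (s.k + 1) + 2 * s.k + 3 < B)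
    (h6 : s.m6 = fun _ => 0) :
    Runs B optimalCmd s (150 * (2 ^ s.k * ((s.k + 2) * (s.k + 2))) + 250 * ((s.k + 1) * (s.k + 1)))
      fun s' => ∃ cur q S bc bi x i c t m4 m5 m6 m7, s' = { s with
        cur := cur, q := q, S := S, bc := bc, bi := bi, x := x, i := i, c := c, t := t
        m4 := m4, m5 := m5, m6 := m6, m7 := m7 } ∧
        IsLayout N s.k ∅ cur q m4 ∧ q = s.k + minBreaks N (Finset.range s.k) s.k ∧
        q ≤ 2 * s.k := by
  have h1 : 1 ≤ 2 ^ s.k := Nat.one_le_two_pow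
  have hx1 : 2 ^ s.k ≤ 2 ^ s.k * (s.k + 1) := Nat.le_mul_of_pos_right _ (by omega)
  have hN1 : ∀ i j, N i j ≤ 1 := fun i j => by rw [hN]; exact h3 _
  have hgeom : ∑ i ∈ Finset.range s.k, 2 ^ i = 2 ^ s.k - 1 := by
    simpa using Nat.geomSum_eq le_rfl s.k
  refine Runs.seq (T₂ := 150 * (2 ^ s.k * ((s.k + 2) * (s.k + 2))) + (11 * (s.k + 1) +
    (4 + 200 * ((s.k + 1) * (s.k + 1))))) (runs_powersCmd (by omega)) ?_ (by nlinarith)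
  rintro _ ⟨i, m7, rfl, h7⟩
  refine Runs.seq (T₂ := 11 * (s.k + 1) + (4 + 200 * ((s.k + 1) * (s.k + 1))))
    (runs_tableCmd (N := N) hN h3 (by simp; omega) rfl h7 h6) ?_ le_rfl
  rintro _ ⟨cur, S, bc, bi, i, c, m5, m6, rfl, hrow⟩
  refine Runs.seq (T₂ := 4 + 200 * ((s.k + 1) * (s.k + 1)))
    (runs_fillCmd (v := fun _ => 1) (by simp; omega) ?_) ?_ (by simp; omega)
  · intro i hi m
    simp
    omega
  · rintro _ ⟨i, m5, rfl, hm5⟩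
    -- The value `2 ^ k - 1` is the code of the full set of coordinates.
    refine Runs.assign_seq (T₂ := 200 * ((s.k + 1) * (s.k + 1))) (by norm_num) (by simp; omega) ?_
      (by simp)
    -- The length so far, plus the breaks still needed, plus the number of coordinates left stays
    -- constant along optimal choices; at the end it is the length itself.
    refine (runs_layoutCmd (d := minBreaks N) (J := fun A c q p => IsLayout N s.k A c q p ∧
      q + minBreaks N A c + A.card = s.k + minBreaks N (Finset.range s.k) s.k)
      ?_ ?_ ?_ ?_ ?_ ?_ ?_ ?_).mono le_rfl ?_
    · simp
      omega
    · exact hm5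
    · simp
      rw [← hgeom]
      exact Finset.sum_congr rfl fun i hi => (h7 i (Finset.mem_range.1 hi)).symm
    · exact h3
    · intro i hi
      have hi : i < s.k := hi
      have : (2 ^ s.k - 1) * (s.k + 1) + (s.k + 1) = 2 ^ s.k * (s.k + 1) := by
        rw [← Nat.succ_mul]
        congr 1
        omega
      simp
      omega
    · intro A hA i hi hiA
      have hi : i < s.k := hi
      have h2 := minBreaks_le_card hN1 A i
      have h4 := Finset.card_le_card hA
      simp at h4
      refine ⟨?_, h2.trans h4⟩
      rw [← hrow A hA i hi.le]
      simp
      congr 3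
      exact Finset.sum_congr rfl fun i hi => h7 i (Finset.mem_range.1 (hA hi))
    · refine ⟨IsLayout.init _ _ _ _ _, ?_⟩
      simp
      omega
    · rintro A c q p ⟨hl, hq⟩ i hi hmin
      have hmin : ∀ j ∈ A, N c i + minBreaks N (A.erase i) i ≤
          N c j + minBreaks N (A.erase j) j := fun j hj => by
        rw [hN, hN]; exact hmin j hj
      have h4 := minBreaks_eq_of_forall_le N hi hmin
      have h5 := Finset.card_erase_add_one hi
      have h8 := hl.step hi
      simp only [hN] at h8 h4 ⊢
      refine ⟨h8, ?_⟩
      simp at *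
      omega
    · rintro _ ⟨cur, q, S, bc, bi, i, c, t, m4, m5, rfl, ⟨hl, hq⟩, hq2⟩
      exact ⟨_, _, _, _, _, _, _, _, _, _, _, _, _, rfl, hl, by simpa using hq, hq2⟩

/-- The algorithm, with parameter `m ≈ 1 / ε`. -/
def mainCmd (m : ℕ) : Cmd :=
  .seq rootCmd (.seq conflictCmd (.seq (fillCmd (.lit 1)) (.seq layoutCmd (.seq
    (.cond (.bin .lt (.lit (m + 1) * .reg 1) (.lit m * .reg 4)) optimalCmd .nop) outputCmd))))

/-- The conflicts between coordinates as recorded in the table; the value is zero if the first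
coordinate is `k`. -/
def conflict (m : ℕ → ℕ) (n k r i j : ℕ) : ℕ := conflictTable m n k r (i * k + j)

theorem conflictTable_le (m : ℕ → ℕ) (n k r a : ℕ) : conflictTable m n k r a ≤ 1 :=
  ite_one_zero_le _

theorem conflict_le (m : ℕ → ℕ) (n k r i j : ℕ) : conflict m n k r i j ≤ 1 := ite_one_zero_le _

/-- Row `k` begins at address `k * k`, just beyond the table, where all entries are zero: the
virtual start conflicts with nothing. -/
theorem conflict_top (m : ℕ → ℕ) (n k r j : ℕ) : conflict m n k r k j = 0 := by
  simp [conflict, conflictTable]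

theorem conflict_eq {m : ℕ → ℕ} {n k r i j : ℕ} (hi : i < k) (hj : j < k) : conflict m n k r i j =
    if ∃ u < n, bitDiff m k r u i = 1 ∧ bitDiff m k r u j = 1 then 1 else 0 := by
  have h1 : (i * k + j) / k = i := by
    rw [mul_comm, Nat.mul_add_div (by omega), Nat.div_eq_of_lt hj, add_zero]
  have h2 : (i * k + j) % k = j := by rw [mul_comm, Nat.mul_add_mod, Nat.mod_eq_of_lt hj]
  simp only [conflict, conflictTable, h1, h2, mul_add_lt hi hj, true_and]

theorem conflict_comm {m : ℕ → ℕ} {n k r i j : ℕ} (hi : i < k) (hj : j < k) :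
    conflict m n k r i j = conflict m n k r j i := by
  rw [conflict_eq hi hj, conflict_eq hj hi]
  simp only [and_comm]

-- `W` bounds the size of the dynamic program, but only in case the greedy layout `E` of the root
-- found fails the test; this is where the properties of simplex graphs enter. The same `W` controls
-- time and word size.
set_option maxHeartbeats 400000 in
theorem runs_mainCmd {B m W : ℕ} {s : Config} {deg : ℕ → ℕ}
    (hdeg : ∀ v, deg v = ∑ u ∈ Finset.range s.n, s.m1 (v * s.n + u))
    (hm0 : ∀ j, s.m0 j ≤ 1) (hm1 : ∀ j, s.m1 j ≤ 1) (hr : ∃ v < s.n, deg v = s.k)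
    (hkn : s.k ≤ s.n) (hS : s.S = 0) (h2 : s.m2 = fun _ => 0) (h3 : s.m3 = fun _ => 0)
    (h6 : s.m6 = fun _ => 0) (h7 : s.m7 = fun _ => 0)
    (hB : W + 10 * (m + 1) * ((s.n + 1) * (s.n + 1)) < B)
    (hW : ∀ r < s.n, deg r = s.k → ∀ c q E, IsGreedy (conflict s.m0 s.n s.k r) s.k ∅ c q E →
      (m + 1) * s.k < m * q → 2 ^ s.k * ((s.k + 2) * (s.k + 2)) ≤ W) :
    Runs B (mainCmd m) s (1000 * ((s.n + 1) * (s.n + 1) * (s.n + 1)) + 150 * W) fun s' =>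
      ∃ r c q p, r < s.n ∧ deg r = s.k ∧ IsLayout (conflict s.m0 s.n s.k r) s.k ∅ c q p ∧
        (m * q ≤ (m + 1) * s.k ∨
          q = s.k + minBreaks (conflict s.m0 s.n s.k r) (Finset.range s.k) s.k) ∧
        s'.n = max q 1 ∧
        IsSpread s.n s.k (max q 1) (bitDiff s.m0 s.k r) p s'.m2 := by
  have hB1 : W + 10 * ((s.n + 1) * (s.n + 1)) < B := by nlinarith
  have hB2 : W + 10 * (s.n * s.n) + 20 * s.n + 10 < B := by nlinarith
  have hkk : s.k * s.k ≤ s.n * s.n := Nat.mul_le_mul hkn hkn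
  have hnk : s.n * s.k ≤ s.n * s.n := Nat.mul_le_mul_left _ hkn
  have hn1 : s.n ≤ s.n * s.n := Nat.le_mul_self _
  have hmk : (m + 1) * s.k ≤ (m + 1) * ((s.n + 1) * (s.n + 1)) :=
    Nat.mul_le_mul_left _ (by nlinarith)
  have hmq : ∀ q, q ≤ 2 * s.k → m * q ≤ 2 * ((m + 1) * ((s.n + 1) * (s.n + 1))) := by
    intro q hq
    have : m * q ≤ (m + 1) * (2 * s.k) := Nat.mul_le_mul (by omega) hq
    have : (m + 1) * (2 * s.k) = 2 * ((m + 1) * s.k) := by ring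
    omega
  have hm1B : m + 1 ≤ (m + 1) * ((s.n + 1) * (s.n + 1)) :=
    Nat.le_mul_of_pos_right _ (by positivity)
  have hB3 : W + 10 * ((m + 1) * ((s.n + 1) * (s.n + 1))) < B := by rwa [← mul_assoc]
  obtain ⟨P, hP⟩ : ∃ P, P = (s.n + 1) * (s.n + 1) * (s.n + 1) := ⟨_, rfl⟩
  have hP1 : (s.n + 1) * (s.n + 1) ≤ P := by rw [hP]; exact Nat.le_mul_of_pos_right _ (by omega)
  have hP2 : (s.k * s.k + 1) * (s.n + 1) ≤ P := by
    rw [hP]; exact Nat.mul_le_mul_right _ (by nlinarith)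
  have hP3 : s.n + 1 ≤ P := le_trans (Nat.le_mul_of_pos_right _ (by omega)) hP1
  have hP4 : (s.k + 1) * (s.k + 1) ≤ P :=
    le_trans (Nat.mul_le_mul (by omega) (by omega)) hP1
  have hP5 : s.n * s.k + 1 ≤ P := by nlinarith
  rw [← hP]
  refine Runs.seq (T₂ := 900 * P + 150 * W) (runs_rootCmd (by nlinarith) (by omega) hm1
    (by simpa only [hdeg] using hr)) ?_ (by omega)
  rintro _ ⟨r, a, u, c, rfl, hrn, hrk⟩
  rw [← hdeg] at hrk
  refine Runs.seq (T₂ := 800 * P + 150 * W) (runs_conflictCmd (by simp; omega) hm0 hrn h3) ?_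
    (by simp; omega)
  rintro _ ⟨a, u, c, rfl⟩
  refine Runs.seq (T₂ := 780 * P + 150 * W)
    (runs_fillCmd (v := fun _ => 1) (by simp; omega) (by intro i hi m; simp; omega)) ?_
    (by simp; omega)
  rintro _ ⟨i, m5, rfl, hm5⟩
  have hN : ∀ i j, conflict s.m0 s.n s.k r i j = conflictTable s.m0 s.n s.k r (i * s.k + j) :=
    fun i j => rfl
  -- Register `5` and banks `6` and `7` are still zero, so the layout loop runs without look-ahead.
  refine Runs.seq (T₂ := 580 * P + 150 * W) (runs_layoutCmd (d := fun _ _ => 0)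
    (J := fun A c q p => IsLayout (conflict s.m0 s.n s.k r) s.k A c q p ∧
      ∃ E, IsGreedy (conflict s.m0 s.n s.k r) s.k A c q E) ?_ hm5 ?_ (conflictTable_le _ _ _ _)
      ?_ ?_ ?_ ?_) ?_ (by simp; omega)
  · have : (s.k + 1) * (s.k + 1) ≤ (s.n + 1) * (s.n + 1) := Nat.mul_le_mul (by omega) (by omega)
    simp
    omega
  · simp [hS, h7]
  · intro i hi
    have hi : i < s.k := hi
    simp [hS]
    omega
  · intro A hA i hi hiA
    simp [h6]
  · exact ⟨IsLayout.init _ _ _ _ _, _, IsGreedy.init _ _⟩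
  · rintro A c q p ⟨hl, E, hE⟩ i hi hmin
    exact ⟨hl.step hi, hE.step (conflict_le _ _ _ _) (conflict_top _ _ _ _)
      (fun i hi j hj => conflict_comm hi hj) hi (by simpa [conflict] using hmin)⟩
  rintro _ ⟨cur, q, S, bc, bi, i, c, t, m4, m5, rfl, ⟨hl, E, hE⟩, hq2⟩
  have hq2 : q ≤ 2 * s.k := hq2
  have hmq' := hmq q hq2
  refine Runs.seq (T₁ := 300 * P + 150 * W) (T₂ := 200 * P) (R := fun s' =>
    ∃ cur q S bc bi x a u i c t m4 m5 m6 m7, s' = { s with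
        r := r, cur := cur, q := q, S := S, bc := bc, bi := bi, x := x, a := a, u := u, i := i
        c := c, t := t, m3 := conflictTable s.m0 s.n s.k r
        m4 := m4, m5 := m5, m6 := m6, m7 := m7 } ∧
      IsLayout (conflict s.m0 s.n s.k r) s.k ∅ cur q m4 ∧ q ≤ 2 * s.k ∧ (m * q ≤ (m + 1) * s.k ∨
          q = s.k + minBreaks (conflict s.m0 s.n s.k r) (Finset.range s.k) s.k)) ?_ ?_ (by omega)
  · refine Runs.cond (T₁ := 290 * P + 150 * W) ?_ (fun hv => ?_) (fun hv => ?_) (by simp; omega)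
    · simp
      split <;> omega
    · simp at hv
      -- The table of size `2 ^ k (k + 1)` is built only in this branch, where `W` is known to bound
      -- it.
      have hW' := hW r hrn hrk _ _ _ hE hv
      have h4 : 2 ^ s.k * (s.k + 1) ≤ 2 ^ s.k * ((s.k + 2) * (s.k + 2)) :=
        Nat.mul_le_mul_left _ (by nlinarith)
      have h5 : (s.k + 1) * (s.k + 1) ≤ (s.n + 1) * (s.n + 1) :=
        Nat.mul_le_mul (by omega) (by omega)
      refine Runs.mono (T₁ := 150 * (2 ^ s.k * ((s.k + 2) * (s.k + 2))) +
        250 * ((s.k + 1) * (s.k + 1))) (runs_optimalCmd hN (conflictTable_le _ _ _ _) ?_ h6)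
        (by omega) ?_
      · simp
        omega
      rintro _ ⟨cur, q, S, bc, bi, x, i, c, t, m4, m5, m6, m7, rfl, hl, hq, hq2⟩
      exact ⟨_, _, _, _, _, _, _, _, _, _, _, _, _, _, _, rfl, hl, hq2, Or.inr hq⟩
    · simp at hv
      exact Runs.nop ⟨_, _, _, _, _, _, _, _, _, _, _, _, _, _, _, rfl, hl, hq2, Or.inl hv⟩
        (by omega)
  · rintro _ ⟨cur, q, S, bc, bi, x, a, u, i, c, t, m4, m5, m6, m7, rfl, hl, hq2, hq⟩
    have h4 : s.n * (q + 1) ≤ s.n * (2 * s.k + 1) := Nat.mul_le_mul_left _ (by omega)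
    have h5 : s.n * (2 * s.k + 1) = 2 * (s.n * s.k) + s.n := by ring
    refine Runs.mono (T₁ := 100 * (s.n * s.k + 1)) (runs_outputCmd hm0 hrn ?_
      (fun i hi => hl.lt i hi (by simp))
      (fun i hi j hj h => hl.inj i hi (by simp) j hj (by simp) h) h2) (by omega) ?_
    · simp
      omega
    rintro s' ⟨h5, h6⟩
    exact ⟨r, cur, q, m4, hrn, hrk, hl, hq, h5, h6⟩

/-! ## Correctness -/

theorem tableCells_apply {r c : ℕ} (T : Fin r → Fin c → Bool) (i : Fin r) (j : Fin c) :
    tableCells T (i * c + j) = (T i j).toNat := by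
  have h := mul_add_lt i.2 j.2
  have hc : 0 < c := j.pos
  rw [tableCells, dif_pos h]
  congr 2
  · ext
    simp only [Fin.coe_divNat]
    rw [mul_comm, Nat.mul_add_div hc, Nat.div_eq_of_lt j.2, add_zero]
  · ext
    simp only [Fin.coe_modNat]
    rw [mul_comm, Nat.mul_add_mod, Nat.mod_eq_of_lt j.2]

theorem tableCells_le {r c : ℕ} (T : Fin r → Fin c → Bool) (a : ℕ) : tableCells T a ≤ 1 := by
  unfold tableCells
  split
  · exact Bool.toNat_le _
  · omega

theorem bitDiff_tableCells {n k : ℕ} (β : Fin n → Fin k → Bool) (r u : Fin n) (i : Fin k) :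
    bitDiff (tableCells β) k r u i = if β u i ≠ β r i then 1 else 0 := by
  rw [bitDiff, tableCells_apply, tableCells_apply]
  cases β u i <;> cases β r i <;> rfl

theorem conflict_tableCells {n k : ℕ} (β : Fin n → Fin k → Bool) (r : Fin n) (i j : Fin k) :
    conflict (tableCells β) n k r i j = 1 ↔ Conflict β r i j := by
  rw [conflict_eq i.2 j.2]
  have : (∃ u < n, bitDiff (tableCells β) k r u i = 1 ∧ bitDiff (tableCells β) k r u j = 1) ↔
      Conflict β r i j := by
    constructor
    · rintro ⟨u, hu, h1, h2⟩
      have h1' := bitDiff_tableCells β r ⟨u, hu⟩ i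
      have h2' := bitDiff_tableCells β r ⟨u, hu⟩ j
      refine ⟨⟨u, hu⟩, fun h => ?_, fun h => ?_⟩
      · rw [if_neg (not_not.2 h)] at h1'
        exact absurd (h1.symm.trans h1') (by norm_num)
      · rw [if_neg (not_not.2 h)] at h2'
        exact absurd (h2.symm.trans h2') (by norm_num)
    · rintro ⟨u, h1, h2⟩
      exact ⟨u, u.2, by rw [bitDiff_tableCells, if_pos h1], by rw [bitDiff_tableCells, if_pos h2]⟩
  rw [← this]
  split <;> simp_all

/-- The initial configuration with tables `m0` and `m1`. -/
def inputConfig (n k : ℕ) (m0 m1 : ℕ → ℕ) : Config where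
  n := n
  k := k
  r := 0
  cur := 0
  q := 0
  S := 0
  bc := 0
  bi := 0
  x := 0
  a := 0
  u := 0
  i := 0
  c := 0
  t := 0
  m0 := m0
  m1 := m1
  m2 := fun _ => 0
  m3 := fun _ => 0
  m4 := fun _ => 0
  m5 := fun _ => 0
  m6 := fun _ => 0
  m7 := fun _ => 0

open Classical in
theorem inputState_eq {n k : ℕ} (H : SimpleGraph (Fin n)) (β : Fin n → Fin k → Bool) :
    inputState H β =
      (inputConfig n k (tableCells β) (tableCells fun u v => decide (H.Adj u v))).st := by
  refine congrArg₂ State.mk ?_ ?_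
  · funext x
    rcases x with _ | _ | x
    · rfl
    · rfl
    · simp only [Config.regs, inputConfig]
      split <;> first | rfl | simp_all
  · funext x
    rcases x with _ | _ | x
    · rfl
    · rfl
    · simp only [Config.banks, inputConfig]
      split <;> first | rfl | simp_all

open Classical in
theorem sum_tableCells_adj {n : ℕ} (H : SimpleGraph (Fin n)) (v : Fin n) :
    ∑ u ∈ Finset.range n, tableCells (fun u v => decide (H.Adj u v)) (v * n + u) =
      (Finset.univ.filter (H.Adj v)).card := by
  rw [Finset.sum_range, Finset.card_filter]
  refine Finset.sum_congr rfl fun u _ => ?_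
  rw [tableCells_apply]
  by_cases h : H.Adj v u <;> simp [h]

theorem exists_fdim_eq {V : Type*} {H : SimpleGraph V}
    (h : ∃ f, 1 ≤ f ∧ ∃ φ, IsIsometricEmbedding H (fibonacciCube f) φ) :
    ∃ f : ℕ, fdim H = f ∧ 1 ≤ f ∧ ∃ φ, IsIsometricEmbedding H (fibonacciCube f) φ := by
  classical
  refine ⟨Nat.find h, ?_, Nat.find_spec h⟩
  apply le_antisymm
  · exact iInf₂_le (Nat.find h) (Nat.find_spec h)
  · exact le_iInf₂ fun g hg => by exact_mod_cast Nat.find_min' h hg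

/-- Complementing by a fixed string `r`, moving coordinates to distinct positions and padding with
zeros all preserve Hamming distances. -/
theorem hammingDist_spread {k f : ℕ} {p : Fin k → Fin f} (hp : Function.Injective p)
    {x y r : Fin k → Bool} {x' y' : Fin f → Bool}
    (hx : ∀ j, x' j = true ↔ ∃ i, p i = j ∧ x i ≠ r i)
    (hy : ∀ j, y' j = true ↔ ∃ i, p i = j ∧ y i ≠ r i) :
    hammingDist x' y' = hammingDist x y := by
  have : Finset.univ.filter (fun j => x' j ≠ y' j) =
      (Finset.univ.filter (fun i => x i ≠ y i)).image p := by
    have hval : ∀ {z : Fin k → Bool} {z' : Fin f → Bool},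
        (∀ j, z' j = true ↔ ∃ i, p i = j ∧ z i ≠ r i) → ∀ i, z' (p i) = true ↔ z i ≠ r i := by
      intro z z' hz i
      rw [hz]
      constructor
      · rintro ⟨i', h, h'⟩
        rwa [← hp h]
      · exact fun h => ⟨i, rfl, h⟩
    have hpt : ∀ i, x' (p i) ≠ y' (p i) ↔ x i ≠ y i := by
      intro i
      have h1 := hval hx i
      have h2 := hval hy i
      revert h1 h2
      cases x' (p i) <;> cases y' (p i) <;> cases x i <;> cases y i <;> cases r i <;> simp
    ext j
    simp only [Finset.mem_filter, Finset.mem_univ, true_and, Finset.mem_image]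
    constructor
    · intro h
      have : ∃ i, p i = j := by
        by_contra hne
        apply h
        have h1 : ¬ x' j = true := fun h => hne (((hx j).1 h).imp fun _ h => h.1)
        have h2 : ¬ y' j = true := fun h => hne (((hy j).1 h).imp fun _ h => h.1)
        rw [Bool.eq_false_of_not_eq_true h1, Bool.eq_false_of_not_eq_true h2]
      obtain ⟨i, rfl⟩ := this
      exact ⟨i, (hpt i).1 h, rfl⟩
    · rintro ⟨i, h, rfl⟩
      exact (hpt i).2 h
  rw [hammingDist, this, Finset.card_image_of_injective _ hp, hammingDist]

/-- A complete layout without conflicts at consecutive positions yields an isometric embedding. -/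
theorem exists_embedding {n k q c : ℕ} {H : SimpleGraph (Fin n)} {β : Fin n → Fin k → Bool}
    (hβ : IsIsometricEmbedding H (cube k) β) {r : Fin n} {p : ℕ → ℕ}
    (hl : IsLayout (conflict (tableCells β) n k r) k ∅ c q p) {s : Config} (hs : s.n = max q 1)
    (hm : IsSpread n k (max q 1) (bitDiff (tableCells β) k r) p s.m2) :
    ∃ γ : Fin n → {u : Fin (max q 1) → Bool // IsFibString u},
      IsIsometricEmbedding H (fibonacciCube (max q 1)) γ ∧
      IsOutput s.st (max q 1) (fun v => (γ v).1) := by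
  classical
  let P : Fin k → Fin (max q 1) := fun i =>
    ⟨p i, by have := hl.lt i i.2 (by simp); omega⟩
  have hP : Function.Injective P := fun i j hij =>
    Fin.ext (hl.inj i i.2 (by simp) j j.2 (by simp) (congrArg Fin.val hij))
  -- Two consecutive ones in the string of `u` would make `u` a witness of a conflict between
  -- coordinates at consecutive positions.
  have hfib : ∀ u, IsFibString (fun j => decide (∃ i, P i = j ∧ β u i ≠ β r i)) := by
    rintro u j j' hj ⟨h1, h2⟩
    obtain ⟨i, rfl, hi⟩ := of_decide_eq_true h1
    obtain ⟨i', rfl, hi'⟩ := of_decide_eq_true h2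
    have h3 := hl.fib i i.2 (by simp) i' i'.2 (by simp) hj
    have h4 := (conflict_tableCells β r i i').2 ⟨u, hi, hi'⟩
    omega
  refine ⟨fun u => ⟨_, hfib u⟩, isIsometricEmbedding_fibonacciCube hβ fun u v =>
    hammingDist_spread hP (r := β r) (by simp) (by simp), hs, fun v j => ?_⟩
  obtain ⟨h1, h2⟩ := hm v v.2
  change s.m2 _ = _
  by_cases h : ∃ i, P i = j
  · obtain ⟨i, rfl⟩ := h
    rw [show s.m2 (v * max q 1 + (P i : ℕ)) = _ from h1 i i.2, bitDiff_tableCells]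
    simp only [hP.eq_iff, exists_eq_left]
    by_cases h : β v i = β r i <;> simp [h]
  · rw [h2 j j.2 (fun i hi hij => h ⟨⟨i, hi⟩, Fin.ext hij⟩), eq_comm, Bool.toNat_eq_zero]
    exact decide_eq_false fun ⟨i, hi, _⟩ => h ⟨i, hi⟩

/-- Any embedding places the coordinates injectively below `f` without conflicts at consecutive
positions, so the bound for placements applies, with the virtual start `k` before position `0`. -/
theorem card_add_minBreaks_le_of_embedding {n k f : ℕ} {H : SimpleGraph (Fin n)}
    {β : Fin n → Fin k → Bool} (hβ : IsIsometricEmbedding H (cube k) β) {r : Fin n}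
    {nb : Fin k → Fin n} (hnb : ∀ i, DiffersAt (β r) (β (nb i)) i)
    {φ : Fin n → {u : Fin f → Bool // IsFibString u}}
    (hφ : IsIsometricEmbedding H (fibonacciCube f) φ) :
    k + minBreaks (conflict (tableCells β) n k r) (Finset.range k) k ≤ f := by
  obtain ⟨c, hc, hcons⟩ := exists_positions hβ hφ hnb
  obtain ⟨p, hp⟩ : ∃ p : ℕ → ℕ, ∀ i (hi : i < k), p i = c ⟨i, hi⟩ :=
    ⟨fun i => if h : i < k then c ⟨i, h⟩ else 0, fun i hi => dif_pos hi⟩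
  have := card_add_minBreaks_le (conflict_le (tableCells β) n k r) (f := f)
    (p := p) (Finset.range k) k 0 (Nat.zero_le _)
    ?_ ?_ (fun _ _ => Nat.zero_le _) (fun i _ _ => conflict_top _ _ _ _ i) ?_
  · simpa using this
  · intro i hi j hj hij
    have hi := Finset.mem_range.1 hi
    have hj := Finset.mem_range.1 hj
    rw [hp i hi, hp j hj] at hij
    exact congrArg Fin.val (hc (Fin.ext hij))
  · intro i hi
    have hi := Finset.mem_range.1 hi
    rw [hp i hi]
    exact (c _).2
  · intro i hi j hj hij
    have hi := Finset.mem_range.1 hi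
    have hj := Finset.mem_range.1 hj
    rw [hp i hi, hp j hj] at hij
    have h1 := conflict_le (tableCells β) n k r i j
    have h2 := mt (conflict_tableCells β r ⟨i, hi⟩ ⟨j, hj⟩).1 (hcons _ _ hij)
    dsimp only at h2
    omega

/-! ### Numerical estimates for table size, word size, time and ratio -/

theorem succ_sq_le (b : ℕ) : (b + 1) * (b + 1) ≤ 4 * 2 ^ b := by
  induction b with
  | zero => norm_num
  | succ b ih =>
    rcases Nat.lt_or_ge b 2 with hb | hb
    · interval_cases b <;> norm_num
    · rw [pow_succ]
      nlinarith

/-- If the greedy layout is bad then `k` is only logarithmic. -/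
theorem two_pow_mul_le {k m b n : ℕ} (hk : k < m * b) (hb : 2 ^ b ≤ n) :
    2 ^ k * ((k + 2) * (k + 2)) ≤ 4 * ((m + 1) * (m + 1)) * n ^ (m + 1) := by
  have h1 : 2 ^ k ≤ n ^ m := calc
    2 ^ k ≤ 2 ^ (m * b) := Nat.pow_le_pow_right (by norm_num) hk.le
    _ = (2 ^ b) ^ m := by rw [mul_comm, pow_mul]
    _ ≤ n ^ m := Nat.pow_le_pow_left hb m
  have h2 : k + 2 ≤ (m + 1) * (b + 1) := by nlinarith
  -- The polynomial factor costs just one further power of `n`, because `(b + 1)² ≤ 4 · 2 ^ b ≤ 4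
  -- n`.
  have h3 : (k + 2) * (k + 2) ≤ 4 * ((m + 1) * (m + 1)) * n := calc
    (k + 2) * (k + 2) ≤ ((m + 1) * (b + 1)) * ((m + 1) * (b + 1)) := Nat.mul_le_mul h2 h2
    _ = (m + 1) * (m + 1) * ((b + 1) * (b + 1)) := by ring
    _ ≤ (m + 1) * (m + 1) * (4 * n) := Nat.mul_le_mul_left _ ((succ_sq_le b).trans (by omega))
    _ = _ := by ring
  calc 2 ^ k * ((k + 2) * (k + 2)) ≤ n ^ m * (4 * ((m + 1) * (m + 1)) * n) := Nat.mul_le_mul h1 h3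
    _ = _ := by ring

/-- With `X = 2 ^ Nat.size n`, which exceeds `n`, each factor is at most a power of `X`; in
particular `m + 1 ≤ 2 ^ m ≤ X ^ m`. Both summands are at most `X ^ (3 * m + 6)`, and the two spare
exponents absorb the sum. -/
theorem word_bound {n m : ℕ} (hn : 1 ≤ n) :
    4 * ((m + 1) * (m + 1)) * n ^ (m + 1) + 10 * (m + 1) * ((n + 1) * (n + 1)) <
      2 ^ ((3 * m + 8) * Nat.size n) := by
  obtain ⟨X, hX⟩ : ∃ X, X = 2 ^ Nat.size n := ⟨_, rfl⟩
  have hnX : n + 1 ≤ X := hX ▸ Nat.lt_size_self n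
  have hX2 : 2 ≤ X := by omega
  have hm : m + 1 ≤ X ^ m := (Nat.lt_two_pow_self).trans_le (Nat.pow_le_pow_left hX2 m)
  have h1 : 4 * ((m + 1) * (m + 1)) * n ^ (m + 1) ≤ X ^ (3 * m + 6) := calc
    _ ≤ X ^ 2 * (X ^ m * X ^ m) * X ^ (m + 1) :=
        Nat.mul_le_mul (Nat.mul_le_mul (by nlinarith) (Nat.mul_le_mul hm hm))
          (Nat.pow_le_pow_left (by omega) _)
    _ = X ^ (3 * m + 3) := by ring
    _ ≤ _ := Nat.pow_le_pow_right (by omega) (by omega)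
  have h10 : 10 ≤ X ^ 4 := le_trans (by norm_num) (Nat.pow_le_pow_left hX2 4)
  have h2 : 10 * (m + 1) * ((n + 1) * (n + 1)) ≤ X ^ (3 * m + 6) := calc
    _ ≤ X ^ 4 * X ^ m * (X * X) := Nat.mul_le_mul (Nat.mul_le_mul h10 hm) (Nat.mul_le_mul hnX hnX)
    _ = X ^ (m + 6) := by ring
    _ ≤ _ := Nat.pow_le_pow_right (by omega) (by omega)
  have h3 : 4 * X ^ (3 * m + 6) ≤ X ^ (3 * m + 8) := by
    have : X ^ (3 * m + 8) = X ^ 2 * X ^ (3 * m + 6) := by ring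
    rw [this]
    exact Nat.mul_le_mul_right _ (by nlinarith)
  have h4 : 0 < X ^ (3 * m + 6) := by positivity
  rw [mul_comm (3 * m + 8), pow_mul, ← hX]
  omega

/-- Both exponents fit: `m + 1 ≤ 2 + 1/ε` by the choice of `m`, and `3 ≤ 2 + 1/ε` because `ε < 1`.
-/
theorem time_bound {n m t : ℕ} {ε : ℝ} (hn : 1 ≤ n) (hε₀ : 0 < ε) (hε₁ : ε < 1)
    (hm : (m : ℝ) ≤ 1 / ε + 1)
    (ht : t ≤ 1000 * ((n + 1) * (n + 1) * (n + 1)) +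
      150 * (4 * ((m + 1) * (m + 1)) * n ^ (m + 1))) :
    (t : ℝ) ≤ (8000 + 600 * ((m + 1) * (m + 1))) * (n : ℝ) ^ (2 + 1 / ε) := by
  have hn' : (1 : ℝ) ≤ n := by exact_mod_cast hn
  have hε : 1 ≤ 1 / ε := by rw [le_div_iff₀ hε₀]; linarith
  have h1 : (n : ℝ) ^ 3 ≤ (n : ℝ) ^ (2 + 1 / ε) := by
    rw [← Real.rpow_natCast]
    exact Real.rpow_le_rpow_of_exponent_le hn' (by push_cast; linarith)
  have h2 : (n : ℝ) ^ (m + 1) ≤ (n : ℝ) ^ (2 + 1 / ε) := by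
    rw [← Real.rpow_natCast]
    exact Real.rpow_le_rpow_of_exponent_le hn' (by push_cast; linarith)
  have h3 : (n + 1) * (n + 1) * (n + 1) ≤ 8 * n ^ 3 := by
    calc (n + 1) * (n + 1) * (n + 1) ≤ (2 * n) * (2 * n) * (2 * n) := by gcongr <;> omega
      _ = _ := by ring
  have h4 : t ≤ 8000 * n ^ 3 + 600 * ((m + 1) * (m + 1)) * n ^ (m + 1) := by
    refine ht.trans ?_
    have : 150 * (4 * ((m + 1) * (m + 1)) * n ^ (m + 1)) =
      600 * ((m + 1) * (m + 1)) * n ^ (m + 1) := by ring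
    omega
  calc (t : ℝ) ≤ 8000 * (n : ℝ) ^ 3 + 600 * ((m + 1) * (m + 1)) * (n : ℝ) ^ (m + 1) := by
        exact_mod_cast h4
    _ ≤ 8000 * (n : ℝ) ^ (2 + 1 / ε) + 600 * ((m + 1) * (m + 1)) * (n : ℝ) ^ (2 + 1 / ε) := by
        gcongr
    _ = _ := by ring

/-- An accepted greedy layout is compared with `k ≤ f`, using `1/m ≤ ε`; an optimal layout satisfies
`q ≤ f` outright. Replacing `q` by `max q 1` is harmless as `1 ≤ f`. -/
theorem ratio_bound {m k q mb f : ℕ} {ε : ℝ} (hε₀ : 0 < ε) (hm : 1 / ε ≤ m) (hf : 1 ≤ f)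
    (hkf : k + mb ≤ f) (h : m * q ≤ (m + 1) * k ∨ q = k + mb) :
    ((max q 1 : ℕ) : ℝ) ≤ (1 + ε) * f := by
  have hf' : (1 : ℝ) ≤ f := by exact_mod_cast hf
  have hε : 0 ≤ ε * f := by positivity
  have hmε : 1 ≤ m * ε := by rwa [div_le_iff₀ hε₀] at hm
  have hm0 : (0 : ℝ) < m := lt_of_lt_of_le (by positivity) hm
  rw [Nat.cast_max, max_le_iff]
  constructor
  · rcases h with h | h
    · have h1 : m * q ≤ (m + 1) * f := h.trans (Nat.mul_le_mul_left _ (by omega))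
      have h2 : (m : ℝ) * q ≤ (m + 1) * f := by exact_mod_cast h1
      have h3 : (m : ℝ) * q ≤ m * ((1 + ε) * f) := by nlinarith
      exact le_of_mul_le_mul_left h3 hm0
    · have : (q : ℝ) ≤ f := by exact_mod_cast h ▸ hkf
      linarith
  · push_cast
    linarith

end FibDim

/-- For every constant `ε ∈ (0,1)` there is a program which, given a simplex graph `H` with `n`
vertices and an isometric embedding `β` of `H` into `Q_k`, `k = idim H`, computes in
`O(n ^ (2 + 1/ε))` steps on a machine with words of `O(log n)` bits an isometric embedding `γ` of
`H` into a Fibonacci cube `Γ_{f'}` with `f' ≤ (1 + ε) fdim H`. -/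
theorem mainTheorem6 (ε : ℝ) (hε₀ : 0 < ε) (hε₁ : ε < 1) :
    ∃ (prog : FibDim.Cmd) (c : ℕ) (C : ℝ),
      ∀ (n k : ℕ) (H : SimpleGraph (Fin n)) (β : Fin n → Fin k → Bool),
        FibDim.IsSimplexGraph H →
        FibDim.idim H = k →
        FibDim.IsIsometricEmbedding H (FibDim.cube k) β →
        ∃ (t : ℕ) (final : FibDim.State),
          FibDim.Exec (2 ^ (c * Nat.size n)) prog (FibDim.inputState H β) t final ∧
          (t : ℝ) ≤ C * (n : ℝ) ^ (2 + 1 / ε) ∧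
          ∃ (f' f : ℕ) (γ : Fin n → {u : Fin f' → Bool // FibDim.IsFibString u}),
            1 ≤ f' ∧
            FibDim.IsIsometricEmbedding H (FibDim.fibonacciCube f') γ ∧
            FibDim.IsOutput final f' (fun v => (γ v).1) ∧
            FibDim.fdim H = f ∧
            (f' : ℝ) ≤ (1 + ε) * f := by
  classical
  -- Rounding up gives `1/m ≤ ε` for the ratio, and costs at most one in the exponent of the running
  -- time.
  obtain ⟨m, hm⟩ : ∃ m, m = ⌈1 / ε⌉₊ := ⟨_, rfl⟩
  have hm1 : 1 / ε ≤ m := hm ▸ Nat.le_ceil _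
  have hm2 : (m : ℝ) ≤ 1 / ε + 1 := hm ▸ (Nat.ceil_lt_add_one (by positivity)).le
  refine ⟨FibDim.mainCmd m, 3 * m + 8, 8000 + 600 * ((m + 1) * (m + 1)), ?_⟩
  intro n k H β hH hk hβ
  obtain ⟨v, hv⟩ := FibDim.exists_root hH hk hβ
  obtain ⟨_, hnb⟩ := FibDim.exists_neighbours hβ hv
  have hkn := FibDim.card_succ_le hnb
  let s := FibDim.inputConfig n k (FibDim.tableCells β)
    (FibDim.tableCells fun u v => decide (H.Adj u v))
  obtain ⟨t, s', hexec, ht, r, c, q, p, hrn, hrk, hl, hq, hs', hspread⟩ :=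
    FibDim.runs_mainCmd (B := 2 ^ ((3 * m + 8) * Nat.size n)) (m := m)
      (W := 4 * ((m + 1) * (m + 1)) * n ^ (m + 1)) (s := s) (fun _ => rfl)
      (FibDim.tableCells_le β) (FibDim.tableCells_le fun u v => decide (H.Adj u v))
      ⟨v, v.2, (FibDim.sum_tableCells_adj H v).trans hv⟩ (show k ≤ n by omega) rfl rfl rfl rfl rfl
      (FibDim.word_bound (by omega)) (by
        intro r hr hrk c q E hE hlt
        obtain ⟨nb, hnb⟩ := FibDim.exists_neighbours (r := ⟨r, hr⟩) hβ
          ((FibDim.sum_tableCells_adj H ⟨r, hr⟩).symm.trans hrk)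
        have hEk : ∀ i ∈ E, i < k := fun i hi => Finset.mem_range.1 (hE.sub hi)
        have hcard := hE.card
        rw [Finset.card_empty, add_zero] at hcard
        -- The greedy length is `q = k + E.card`, so the failed test says exactly that `k < m *
        -- E.card`.
        refine FibDim.two_pow_mul_le (b := E.card) ?_ ?_
        · rw [← hcard] at hlt
          change k < _
          have hlt : (m + 1) * k < m * (E.card + k) := hlt
          nlinarith
        · rw [← Finset.card_attachFin E hEk]
          refine FibDim.two_pow_card_le hH hβ hnb fun i hi j hj hij => ?_
          rw [← FibDim.conflict_tableCells]
          exact hE.pair i (Finset.mem_attachFin _ |>.1 hi) j (Finset.mem_attachFin _ |>.1 hj)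
            (fun h => hij (Fin.ext h)))
  -- The root found by the program may differ from `v`, but every vertex of degree `k` serves as a
  -- base point.
  obtain ⟨_, hnb⟩ := FibDim.exists_neighbours (r := ⟨r, hrn⟩) hβ
    ((FibDim.sum_tableCells_adj H ⟨r, hrn⟩).symm.trans hrk)
  obtain ⟨γ, hγ, hout⟩ := FibDim.exists_embedding (r := ⟨r, hrn⟩) hβ hl hs' hspread
  -- The computed embedding itself shows that the Fibonacci dimension is finite; the lower bound is
  -- then applied to an embedding `φ` of least dimension.
  obtain ⟨f, hf, hf1, φ, hφ⟩ := FibDim.exists_fdim_eq ⟨max q 1, le_max_right _ _, γ, hγ⟩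
  refine ⟨t, s'.st, by rw [FibDim.inputState_eq]; exact hexec,
    FibDim.time_bound (by omega) hε₀ hε₁ hm2 ht, max q 1, f, γ, le_max_right _ _, hγ, hout, hf, ?_⟩
  exact FibDim.ratio_bound hε₀ hm1 hf1
    (FibDim.card_add_minBreaks_le_of_embedding (r := ⟨r, hrn⟩) hβ hnb hφ) hq
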